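/- **Theorem 3.1.** Let $X$ be a complete CAT$(-1)$ space, let $\varepsilon>0$, let $H$ be a subgroup of the isometry group $\mathrm{Iso}(X)$, and let $\mathcal A=\{A_i\}$ be an $H$-invariant family of non-empty closed convex subsets of $X$ that is $\varepsilon$-separated, i.e. the distance between any two distinct members of $\mathcal A$ is at least $\varepsilon$. Suppose that $X\setminus\bigcup_i\mathrm{Int}(A_i)$ is locally compact and that the action of $H$ on $X\setminus\bigcup_i\mathrm{Int}(A_i)$ is properly discontinuous and cocompact. Let $H_i$ be the stabilizer of $A_i$ in $H$. Then $H$ is hyperbolic relative to $\{H_i\}$. Here a group $G$ is called hyperbolic relative to a set $\mathcal P$ of subgroups if $G$ acts on a connected graph $K$ (with edges of length $1$) such that $K$ is Gromov hyperbolic; $K$ is fine, i.e. for every $n$ each edge of $K$ lies in only finitely many circuits (embedded closed paths) of length less than $n$; there are finitely many $G$-orbits of vertices and of edges; edge stabilizers are finite; every member of $\mathcal P$ is the stabilizer of a vertex; and every infinite vertex stabilizer belongs to $\mathcal P$. -/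

import Mathlib

universe u

/-! ### CAT(-1) spaces -/

/-- Any two points `x`, `y` are joined by a geodesic segment, that is, by an isometric
embedding of `[0, dist x y]`. -/
def IsGeodesicSpace (X : Type*) [MetricSpace X] : Prop :=
  ∀ x y : X, ∃ γ : ℝ → X, γ 0 = x ∧ γ (dist x y) = y ∧
    ∀ s ∈ Set.Icc 0 (dist x y), ∀ t ∈ Set.Icc 0 (dist x y), dist (γ s) (γ t) = |s - t|

/-- `p` lies between `x` and `y`. In a geodesic space this says that `p` lies on some
geodesic segment with endpoints `x` and `y` (concatenate segments from `x` to `p` and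
from `p` to `y`). -/
def MetricBetween {X : Type*} [MetricSpace X] (x p y : X) : Prop :=
  dist x p + dist p y = dist x y

/-- A CAT(-1) space: a geodesic space in which geodesic triangles are at least as thin as their
comparison triangles in the hyperbolic plane `ℍ` (of curvature `-1`). Here `x, y, z` is
a triangle, `p` and `q` are points on two of its sides (issuing from the common vertex `x`, an
arbitrary one), `x', y', z'` is a comparison triangle, and `p'`, `q'` are the comparison points,
so that `dist p q ≤ dist p' q'` is the CAT(-1) inequality. -/
structure IsCATNegOne (X : Type*) [MetricSpace X] : Prop where
  geodesic : IsGeodesicSpace X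
  comparison : ∀ (x y z p q : X) (x' y' z' p' q' : UpperHalfPlane),
    MetricBetween x p y → MetricBetween x q z →
    dist x' y' = dist x y → dist y' z' = dist y z → dist x' z' = dist x z →
    dist x' p' = dist x p → dist p' y' = dist p y →
    dist x' q' = dist x q → dist q' z' = dist q z →
    dist p q ≤ dist p' q'

/-- A set is convex if it contains every geodesic segment between two of its points. -/
def IsGeodesicallyConvex {X : Type*} [MetricSpace X] (A : Set X) : Prop :=
  ∀ x ∈ A, ∀ y ∈ A, ∀ p, MetricBetween x p y → p ∈ A

/-- The distance between any two distinct members of the family is at least `r`. -/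
def IsSeparatedFamily {X : Type*} [MetricSpace X] (r : ℝ) (𝒜 : Set (Set X)) : Prop :=
  ∀ A ∈ 𝒜, ∀ B ∈ 𝒜, A ≠ B → ∀ a ∈ A, ∀ b ∈ B, r ≤ dist a b

/-! ### Groups of isometries -/

/-- The action of `H` on the subset `Z` is properly discontinuous. -/
def ActsProperlyDiscontinuouslyOn {X : Type*} [MetricSpace X] (H : Subgroup (X ≃ᵢ X))
    (Z : Set X) : Prop :=
  ∀ K ⊆ Z, IsCompact K → {h : H | ((h.1 '' K) ∩ K).Nonempty}.Finite

/-- The action of `H` on the subset `Z` is cocompact: the translates of a compact set cover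
`Z`. -/
def ActsCocompactlyOn {X : Type*} [MetricSpace X] (H : Subgroup (X ≃ᵢ X))
    (Z : Set X) : Prop :=
  ∃ K ⊆ Z, IsCompact K ∧ ∀ z ∈ Z, ∃ h ∈ H, z ∈ h '' K

/-- The stabilizer in `H` of the subset `A`. -/
def setStabilizer {X : Type*} [MetricSpace X] (H : Subgroup (X ≃ᵢ X)) (A : Set X) :
    Subgroup H where
  carrier := {h | h.1 '' A = A}
  one_mem' := by
    change (fun x => x) '' A = A
    simp
  mul_mem' := by
    intro a b ha hb
    change (fun x => a.1 (b.1 x)) '' A = A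
    rw [← Set.image_image a.1 b.1 A, show b.1 '' A = A from hb]
    exact ha
  inv_mem' := by
    intro a ha
    change a.1.symm '' A = A
    conv_lhs => rw [← (show a.1 '' A = A from ha)]
    rw [Set.image_image]
    simp

/-! ### Relatively hyperbolic groups -/

namespace SimpleGraph

/-- Gromov hyperbolicity of a connected graph with edges of length one: the four point
condition, on the vertices. (Every point of the geometric realization is within `1/2` of
a vertex, so that up to the value of `δ` it does not matter whether the four points range over
the vertices or over the realization.) -/
def IsHyperbolic {V : Type*} (K : SimpleGraph V) : Prop :=
  ∃ δ : ℝ, ∀ x y z w : V,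
    (K.dist x y : ℝ) + K.dist z w ≤
      max ((K.dist x z : ℝ) + K.dist y w) ((K.dist x w : ℝ) + K.dist y z) + 2 * δ

/-- A graph is fine if for each `n` each edge lies in only finitely many circuits
(embedded closed paths) of length less than `n`. -/
def IsFine {V : Type*} (K : SimpleGraph V) : Prop :=
  ∀ (n : ℕ), ∀ e ∈ K.edgeSet,
    {c : Σ v : V, K.Walk v v | c.2.IsCycle ∧ c.2.length < n ∧ e ∈ c.2.edges}.Finite

end SimpleGraph

/-- The stabilizer of the vertex `v` under an action `ρ` of `G` on the graph `K`. -/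
def vertexStabilizer {G : Type*} [Group G] {V : Type*} {K : SimpleGraph V}
    (ρ : G →* (K ≃g K)) (v : V) : Subgroup G where
  carrier := {g | ρ g v = v}
  one_mem' := by simp
  mul_mem' := by
    intro a b ha hb
    change ρ (a * b) v = v
    rw [map_mul]
    change ρ a (ρ b v) = v
    rw [show ρ b v = v from hb]
    exact ha
  inv_mem' := by
    intro a ha
    change ρ a⁻¹ v = v
    rw [map_inv]
    change (ρ a).symm v = v
    conv_lhs => rw [← (show ρ a v = v from ha)]
    simp

/-- `G` is hyperbolic relative to the set `Ps` of subgroups: `G` acts on a connected, fine,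
hyperbolic graph `K` with finite quotient and finite edge stabilizers, such that the members of
`Ps` are vertex stabilizers and every infinite vertex stabilizer is a member of `Ps`. In
particular, if all members of `Ps` are infinite then `Ps` is exactly the set of infinite vertex
stabilizers. -/
def IsHyperbolicRelativeTo (G : Type u) [Group G] (Ps : Set (Subgroup G)) : Prop :=
  ∃ (V : Type u) (K : SimpleGraph V) (ρ : G →* (K ≃g K)),
    K.Connected ∧ K.IsHyperbolic ∧ K.IsFine ∧
    -- finitely many orbits of vertices
    (∃ S : Set V, S.Finite ∧ ∀ v, ∃ s ∈ S, ∃ g, ρ g s = v) ∧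
    -- finitely many orbits of edges
    (∃ S : Set (Sym2 V), S.Finite ∧ ∀ e ∈ K.edgeSet, ∃ s ∈ S, ∃ g, Sym2.map (ρ g) s = e) ∧
    -- finite edge stabilizers
    (∀ e ∈ K.edgeSet, {g : G | Sym2.map (ρ g) e = e}.Finite) ∧
    (∀ P ∈ Ps, ∃ v, vertexStabilizer ρ v = P) ∧
    (∀ v, (vertexStabilizer ρ v : Set G).Infinite → vertexStabilizer ρ v ∈ Ps)

/-!
The group acts on the coned-off graph `ConingNet.graph`: its vertices are the members of the
family `𝒜` and the points of an equivariant, locally finite net `N` in the complement `Z` of the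
interiors, and two vertices are adjacent if as subsets of `X` they come `R`-close, for a small
scale `R`. The scale is chosen such that distinct members of `𝒜` are `3 * R`-separated and that
`R`-neighbourhoods in `Z` of compact sets are relatively compact (`exists_fatten`); it has to be
small because bounded subsets of `Z` need not be relatively compact. Finiteness of the numbers of
orbits and of the edge stabilizers then follows from cocompactness and proper discontinuity, and
vertices are stabilized by the subgroups that stabilize them as subsets of `X`.

The geometry of `X` is derived from one inequality, `IsCATNegOne.cosh_dist_mul_sinh_le`, which
bounds the distance from a vertex of a triangle to a point of the opposite side. Its reformulation
`IsCATNegOne.exists_weighted_point` gives existence of nearest points, the Pythagorean inequality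
`IsCATNegOne.cosh_mul_cosh_le_of_isFoot`, the estimate `IsCATNegOne.quadrilateral` for
quadrilaterals with two obtuse angles, and thin triangles (`IsCATNegOne.exists_center`).

Hyperbolicity: a geodesic of `X` between points represented by adjacent vertices stays close to
these vertices, since the members of `𝒜` are convex. Geodesics of `X` thus form a family of
uniformly thin paths in the graph, and by the guessing geodesics argument
(`CoarseGraphModel.isHyperbolic`) they are close to geodesics of the graph, which is therefore
hyperbolic.

Fineness: by `SimpleGraph.isFine_of_finite_link` it suffices that a path of bounded length which
avoids a vertex `b` and starts at a given neighbour of `b` can end at finitely many neighbours of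
`b` only. This is clear if `b` is a point of the net. If `b` is a member `A` of `𝒜`, project the
path to `A`. The projection runs in `Z`, a step between points of the net becomes a step of size
at most `R`, and the passage through another member `B` of `𝒜` becomes a chain of a bounded number
of such steps: by `IsCATNegOne.exists_chain_bound` this holds for segments that stay away from
`A`, because the distance to `A` grows linearly from its minimum on (`IsCATNegOne.exists_growth`)
and the projection contracts exponentially in this distance (`IsCATNegOne.dist_foot_le_exp`).
Hence the end of the path lies in a compact subset of `Z`, which contains finitely many points of
the net.
-/

/-! ### Comparison triangles in the hyperbolic plane -/

open UpperHalfPlane in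
/-- The point `exp t * I` of the vertical geodesic through `I`, parametrized by arc length. -/
noncomputable def verticalPoint (t : ℝ) : ℍ := ⟨⟨0, Real.exp t⟩, Real.exp_pos t⟩

theorem dist_verticalPoint (s t : ℝ) : dist (verticalPoint s) (verticalPoint t) = |s - t| := by
  have h := UpperHalfPlane.isometry_vertical_line 0
  rw [← Real.dist_eq]
  exact h.dist_eq s t

theorem cosh_dist_verticalPoint (u v t : ℝ) (hv : 0 < v) :
    Real.cosh (dist (⟨⟨u, v⟩, hv⟩ : UpperHalfPlane) (verticalPoint t)) =
      (u ^ 2 + v ^ 2 + Real.exp t ^ 2) / (2 * v * Real.exp t) := by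
  have := Real.exp_pos t
  rw [UpperHalfPlane.cosh_dist']
  simp only [verticalPoint, UpperHalfPlane.re, UpperHalfPlane.im]
  congr 1
  ring

theorem eq_of_cosh_eq_cosh {a b : ℝ} (ha : 0 ≤ a) (hb : 0 ≤ b) (h : Real.cosh a = Real.cosh b) :
    a = b := Real.cosh_injOn ha hb h

/-- Existence of comparison triangles in the hyperbolic plane, together with the formula of Stewart
for the distance from a vertex to a point on the opposite side. -/
theorem exists_comparison_triangle {a b l t : ℝ} (ha : 0 ≤ a) (hb : 0 ≤ b) (hl : 0 < l)
    (ht : 0 ≤ t) (htl : t ≤ l) (h1 : a ≤ b + l) (h2 : b ≤ a + l) (h3 : l ≤ a + b) :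
    ∃ x y z p : UpperHalfPlane, dist y z = l ∧ dist y p = t ∧ dist p z = l - t ∧
      dist x y = a ∧ dist x z = b ∧
      Real.cosh (dist x p) * Real.sinh l =
        Real.cosh a * Real.sinh (l - t) + Real.cosh b * Real.sinh t := by
  have c1 : Real.cosh (l - a) ≤ Real.cosh b := by
    rw [Real.cosh_le_cosh, abs_of_nonneg hb, abs_le]; constructor <;> linarith
  have c2 : Real.cosh b ≤ Real.cosh (a + l) := by
    rw [Real.cosh_le_cosh, abs_of_nonneg hb, abs_of_nonneg (by linarith)]; linarith
  have hexpl : 1 < Real.exp l := Real.one_lt_exp_iff.mpr hl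
  obtain ⟨E, hE⟩ : ∃ E, E = Real.exp l := ⟨_, rfl⟩
  obtain ⟨F, hF⟩ : ∃ F, F = Real.exp a := ⟨_, rfl⟩
  have hE0 : 0 < E := hE ▸ Real.exp_pos l
  have hF0 : 0 < F := hF ▸ Real.exp_pos a
  obtain ⟨B, hB⟩ : ∃ B, B = Real.cosh b := ⟨_, rfl⟩
  have ca : Real.cosh a = (F + F⁻¹) / 2 := by rw [Real.cosh_eq, Real.exp_neg, hF]
  have c1' : (E / F + F / E) / 2 ≤ B := by
    rw [hB]; convert c1 using 1
    rw [Real.cosh_eq, Real.exp_sub, neg_sub, Real.exp_sub, hE, hF]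
  have c2' : B ≤ (F * E + (F * E)⁻¹) / 2 := by
    rw [hB]; convert c2 using 1
    rw [Real.cosh_eq, Real.exp_neg, Real.exp_add, hE, hF]
  have hE1 : 1 < E := hE ▸ hexpl
  -- the height of the third vertex
  have hden : 0 < E * B - (F + F⁻¹) / 2 := by
    have : E * ((E / F + F / E) / 2) ≤ E * B := by gcongr
    have h5 : E * ((E / F + F / E) / 2) = (E ^ 2 / F + F) / 2 := by field_simp
    have h6 : F⁻¹ < E ^ 2 / F := by
      rw [inv_eq_one_div]; gcongr; nlinarith
    linarith
  obtain ⟨v, hv⟩ : ∃ v, v = (E ^ 2 - 1) / (2 * (E * B - (F + F⁻¹) / 2)) := ⟨_, rfl⟩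
  have hv0 : 0 < v := by rw [hv]; apply div_pos <;> nlinarith
  have hvF : v ≤ F := by
    rw [hv, div_le_iff₀ (by linarith)]
    have : F * (2 * (E * ((E / F + F / E) / 2) - (F + F⁻¹) / 2)) ≤
      F * (2 * (E * B - (F + F⁻¹) / 2)) := by gcongr
    refine le_trans (le_of_eq ?_) this
    field_simp; ring
  have hFv : F⁻¹ ≤ v := by
    rw [hv, le_div_iff₀ (by linarith)]
    have : F⁻¹ * (2 * (E * B - (F + F⁻¹) / 2)) ≤
      F⁻¹ * (2 * (E * ((F * E + (F * E)⁻¹) / 2) - (F + F⁻¹) / 2)) := by gcongr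
    refine le_trans this (le_of_eq ?_)
    field_simp; ring
  have hu : 0 ≤ v * (F + F⁻¹) - v ^ 2 - 1 := by
    have : 0 ≤ (F - v) * (v - F⁻¹) := mul_nonneg (by linarith) (by linarith)
    have h5 : F * F⁻¹ = 1 := mul_inv_cancel₀ hF0.ne'
    nlinarith
  obtain ⟨u, hu2⟩ : ∃ u, u = √(v * (F + F⁻¹) - v ^ 2 - 1) := ⟨_, rfl⟩
  have hus : u ^ 2 = v * (F + F⁻¹) - v ^ 2 - 1 := by rw [hu2, Real.sq_sqrt hu]
  have hvE : E ^ 2 - 1 = v * (2 * (E * B - (F + F⁻¹) / 2)) := by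
    rw [hv, div_mul_cancel₀ _ (mul_pos two_pos hden).ne']
  have hxy : Real.cosh (dist (⟨⟨u, v⟩, hv0⟩ : UpperHalfPlane) (verticalPoint 0)) = Real.cosh a := by
    rw [cosh_dist_verticalPoint, Real.exp_zero, ca, div_eq_div_iff (by positivity) (by positivity)]
    rw [hus]; ring
  have hxz : Real.cosh (dist (⟨⟨u, v⟩, hv0⟩ : UpperHalfPlane) (verticalPoint l)) = Real.cosh b := by
    rw [cosh_dist_verticalPoint, ← hE, ← hB, div_eq_iff (by positivity)]
    rw [hus]; linarith
  refine ⟨⟨⟨u, v⟩, hv0⟩, verticalPoint 0, verticalPoint l, verticalPoint t, ?_, ?_, ?_,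
    eq_of_cosh_eq_cosh dist_nonneg ha hxy, eq_of_cosh_eq_cosh dist_nonneg hb hxz, ?_⟩
  · rw [dist_verticalPoint, zero_sub, abs_neg, abs_of_pos hl]
  · rw [dist_verticalPoint, zero_sub, abs_neg, abs_of_nonneg ht]
  · rw [dist_verticalPoint, abs_sub_comm, abs_of_nonneg (by linarith)]
  · rw [← hxy, ← hxz, cosh_dist_verticalPoint, cosh_dist_verticalPoint, cosh_dist_verticalPoint,
      Real.sinh_eq, Real.sinh_eq, Real.sinh_eq, neg_sub, Real.exp_sub, Real.exp_sub, Real.exp_neg,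
      Real.exp_neg, Real.exp_zero]
    have := Real.exp_pos t
    have := Real.exp_pos l
    field_simp
    ring

section CAT

variable {X : Type*} [MetricSpace X]

theorem MetricBetween.symm {x p y : X} (h : MetricBetween x p y) : MetricBetween y p x := by
  unfold MetricBetween at *
  rw [dist_comm y p, dist_comm p x, dist_comm y x]; linarith

theorem metricBetween_left (x y : X) : MetricBetween x x y := by simp [MetricBetween]

theorem metricBetween_right (x y : X) : MetricBetween x y y := by simp [MetricBetween]

/-- The CAT(-1) inequality for a vertex and a point of the opposite side, written as the bound
given by the formula of Stewart in the hyperbolic plane. This is the only consequence of the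
comparison axiom that is used. -/
theorem IsCATNegOne.cosh_dist_mul_sinh_le (hX : IsCATNegOne X) (x : X) {y z p : X}
    (hp : MetricBetween y p z) :
    Real.cosh (dist x p) * Real.sinh (dist y z) ≤
      Real.cosh (dist x y) * Real.sinh (dist p z) + Real.cosh (dist x z) * Real.sinh (dist y p) := by
  have hp' : dist y p + dist p z = dist y z := hp
  have n1 : 0 ≤ dist y p := dist_nonneg
  have n2 : 0 ≤ dist p z := dist_nonneg
  rcases (dist_nonneg : 0 ≤ dist y z).eq_or_lt with h0 | hl
  · rw [← h0, Real.sinh_zero, mul_zero]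
    have := Real.cosh_pos (dist x y)
    have := Real.cosh_pos (dist x z)
    have := Real.sinh_nonneg_iff.mpr n1
    have := Real.sinh_nonneg_iff.mpr n2
    positivity
  · obtain ⟨x', y', z', p', e1, e2, e3, e4, e5, e6⟩ := exists_comparison_triangle
      (a := dist x y) (b := dist x z) (t := dist y p) dist_nonneg dist_nonneg hl n1 (by linarith)
      (by rw [dist_comm y z]; exact dist_triangle x z y) (dist_triangle x y z)
      (by rw [dist_comm x y]; exact dist_triangle y x z)
    have key : dist p x ≤ dist p' x' := by
      refine hX.comparison y z x p x y' z' x' p' x' hp (metricBetween_right _ _) e1 ?_ ?_ e2 ?_ ?_ ?_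
      · rw [dist_comm, e5, dist_comm]
      · rw [dist_comm, e4, dist_comm]
      · rw [e3]; linarith
      · rw [dist_comm, e4, dist_comm]
      · simp
    have : dist p z = dist y z - dist y p := by linarith
    rw [this, ← e6]
    have h7 : Real.cosh (dist x p) ≤ Real.cosh (dist x' p') := by
      rw [Real.cosh_le_cosh, abs_of_nonneg dist_nonneg, abs_of_nonneg dist_nonneg, dist_comm x,
        dist_comm x']; exact key
    exact mul_le_mul_of_nonneg_right h7 (Real.sinh_nonneg_iff.mpr hl.le)

end CAT

/-! ### Weighted points, nearest points and quadrilaterals -/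

theorem one_add_sq_div_two_le_cosh (x : ℝ) : 1 + x ^ 2 / 2 ≤ Real.cosh x := by
  have h1 : Real.cosh x = 1 + 2 * Real.sinh (x / 2) ^ 2 := by
    have := Real.cosh_two_mul (x / 2)
    have h2 := Real.cosh_sq (x / 2)
    rw [show 2 * (x / 2) = x by ring] at this
    linarith
  have h2 : (x / 2) ^ 2 ≤ Real.sinh (x / 2) ^ 2 := by
    rw [sq_le_sq]
    rcases le_total 0 (x / 2) with h | h
    · rw [abs_of_nonneg h, abs_of_nonneg (Real.sinh_nonneg_iff.mpr h)]
      exact Real.self_le_sinh_iff.mpr h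
    · rw [abs_of_nonpos h, abs_of_nonpos (Real.sinh_nonpos_iff.mpr h)]
      linarith [Real.sinh_le_self_iff.mpr h]
  nlinarith

theorem cosh_le_cosh_of_le {a b : ℝ} (ha : 0 ≤ a) (h : a ≤ b) : Real.cosh a ≤ Real.cosh b := by
  rw [Real.cosh_le_cosh, abs_of_nonneg ha, abs_of_nonneg (ha.trans h)]; exact h

theorem le_of_cosh_le_cosh {a b : ℝ} (hb : 0 ≤ b) (h : Real.cosh a ≤ Real.cosh b) : a ≤ b := by
  rw [Real.cosh_le_cosh, abs_of_nonneg hb] at h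
  exact (le_abs_self a).trans h

section CAT

variable {X : Type*} [MetricSpace X]

theorem IsCATNegOne.exists_dist_eq (hX : IsCATNegOne X) (x y : X) {t : ℝ} (h0 : 0 ≤ t)
    (ht : t ≤ dist x y) : ∃ p, MetricBetween x p y ∧ dist x p = t ∧ dist p y = dist x y - t := by
  obtain ⟨γ, g0, g1, hγ⟩ := hX.geodesic x y
  have e1 : dist x (γ t) = t := by
    have := hγ 0 ⟨le_rfl, dist_nonneg⟩ t ⟨h0, ht⟩
    rw [g0, zero_sub, abs_neg, abs_of_nonneg h0] at this
    exact this
  have e2 : dist (γ t) y = dist x y - t := by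
    have := hγ t ⟨h0, ht⟩ _ ⟨dist_nonneg, le_rfl⟩
    rw [g1, abs_sub_comm, abs_of_nonneg (by linarith)] at this
    exact this
  exact ⟨γ t, by unfold MetricBetween; linarith, e1, e2⟩

/-- Geodesics in a CAT(-1) space are unique. -/
theorem IsCATNegOne.eq_of_metricBetween (hX : IsCATNegOne X) {x y p q : X}
    (hp : MetricBetween x p y) (hq : MetricBetween x q y) (h : dist x p = dist x q) : p = q := by
  have h1 := hX.cosh_dist_mul_sinh_le p hq
  have hp' : dist x p + dist p y = dist x y := hp
  have hq' : dist x q + dist q y = dist x y := hq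
  rcases (dist_nonneg : 0 ≤ dist x y).eq_or_lt with h0 | hl
  · have e1 : dist x p = 0 := by
      linarith [dist_nonneg (x := x) (y := p), dist_nonneg (x := p) (y := y)]
    have e2 : dist x q = 0 := h ▸ e1
    exact (dist_eq_zero.mp e1).symm.trans (dist_eq_zero.mp e2)
  · have e2 : dist q y = dist p y := by linarith
    rw [e2, ← h, dist_comm p x] at h1
    have h2 : Real.sinh (dist x y) =
        Real.sinh (dist x p) * Real.cosh (dist p y) + Real.cosh (dist x p) * Real.sinh (dist p y) := by
      rw [← Real.sinh_add, hp']
    have hs : 0 < Real.sinh (dist x y) := Real.sinh_pos_iff.mpr hl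
    have h3 : Real.cosh (dist p q) ≤ 1 := by
      by_contra! hc
      nlinarith
    have h4 := one_add_sq_div_two_le_cosh (dist p q)
    exact dist_eq_zero.mp (pow_eq_zero_iff (two_ne_zero) |>.mp
      (le_antisymm (by linarith) (sq_nonneg _)))

/-- The CAT(-1) inequality for the point of a segment that corresponds, in the hyperboloid model,
to the normalized combination of the endpoints with weights `α` and `β`. -/
theorem IsCATNegOne.exists_weighted_point (hX : IsCATNegOne X) (y z : X) {α β : ℝ} (hα : 0 ≤ α)
    (hβ : 0 ≤ β) : ∃ p, MetricBetween y p z ∧ ∀ x,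
      Real.cosh (dist x p) * √(α ^ 2 + β ^ 2 + 2 * α * β * Real.cosh (dist y z)) ≤
        α * Real.cosh (dist x y) + β * Real.cosh (dist x z) := by
  rcases (dist_nonneg : 0 ≤ dist y z).eq_or_lt with h0 | hl
  · refine ⟨y, metricBetween_left _ _, fun x => ?_⟩
    have : y = z := dist_eq_zero.mp h0.symm
    subst this
    rw [dist_self, Real.cosh_zero, show α ^ 2 + β ^ 2 + 2 * α * β * 1 = (α + β) ^ 2 by ring,
      Real.sqrt_sq (by linarith)]
    linarith
  · set l := dist y z
    have hs : 0 < Real.sinh l := Real.sinh_pos_iff.mpr hl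
    have hcont : ContinuousOn (fun t => α * Real.sinh t - β * Real.sinh (l - t)) (Set.Icc 0 l) := by
      apply Continuous.continuousOn
      have := Real.continuous_sinh
      fun_prop
    have := intermediate_value_Icc hl.le hcont
    obtain ⟨t, ⟨ht0, htl⟩, ht⟩ := this (show (0 : ℝ) ∈ _ by
      constructor
      · simp only [Real.sinh_zero, sub_zero, mul_zero, zero_sub, Left.neg_nonpos_iff]; positivity
      · simp only [Real.sinh_zero, sub_self, mul_zero, sub_zero]; positivity)
    obtain ⟨p, hp, p1, p2⟩ := hX.exists_dist_eq y z ht0 htl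
    refine ⟨p, hp, fun x => ?_⟩
    have key := hX.cosh_dist_mul_sinh_le x hp
    rw [p1, p2] at key
    set S := √(α ^ 2 + β ^ 2 + 2 * α * β * Real.cosh l)
    have hS : S ^ 2 = α ^ 2 + β ^ 2 + 2 * α * β * Real.cosh l := by
      apply Real.sq_sqrt
      have := Real.cosh_pos l
      positivity
    have hS0 : 0 ≤ S := Real.sqrt_nonneg _
    have ht' : α * Real.sinh t = β * Real.sinh (l - t) := by simpa [sub_eq_zero] using ht
    have s1 : 0 ≤ Real.sinh t := Real.sinh_nonneg_iff.mpr ht0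
    have s2 : 0 ≤ Real.sinh (l - t) := Real.sinh_nonneg_iff.mpr (by linarith)
    have id : Real.sinh (l - t) ^ 2 + Real.sinh t ^ 2 +
        2 * Real.sinh t * Real.sinh (l - t) * Real.cosh l = Real.sinh l ^ 2 := by
      have e1 := Real.sinh_add (l - t) t
      have e2 := Real.cosh_add (l - t) t
      rw [sub_add_cancel] at e1 e2
      rw [e1, e2]
      have c1 := Real.cosh_sq (l - t)
      have c2 := Real.cosh_sq t
      linear_combination (-Real.sinh t ^ 2) * c1 - Real.sinh (l - t) ^ 2 * c2
    have w1 : S * Real.sinh (l - t) = α * Real.sinh l := by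
      rw [← sq_eq_sq₀ (by positivity) (by positivity), mul_pow, mul_pow, hS, ← id]
      linear_combination (-(α * Real.sinh t + β * Real.sinh (l - t)) -
        2 * α * Real.sinh (l - t) * Real.cosh l) * ht'
    have w2 : S * Real.sinh t = β * Real.sinh l := by
      rw [← sq_eq_sq₀ (by positivity) (by positivity), mul_pow, mul_pow, hS, ← id]
      linear_combination ((α * Real.sinh t + β * Real.sinh (l - t)) +
        2 * β * Real.sinh t * Real.cosh l) * ht'
    have := mul_le_mul_of_nonneg_left key hS0
    refine le_of_mul_le_mul_right ?_ hs
    calc Real.cosh (dist x p) * S * Real.sinh l = S * (Real.cosh (dist x p) * Real.sinh l) := by ring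
      _ ≤ _ := this
      _ = Real.cosh (dist x y) * (S * Real.sinh (l - t)) +
          Real.cosh (dist x z) * (S * Real.sinh t) := by ring
      _ = _ := by rw [w1, w2]; ring

/-- `a` is a nearest point of `A` to `x`. -/
def IsFoot (A : Set X) (x a : X) : Prop := a ∈ A ∧ ∀ b ∈ A, dist x a ≤ dist x b

/-- Hyperbolic Pythagorean inequality for the obtuse angle at a nearest point of a convex set. -/
theorem IsCATNegOne.cosh_mul_cosh_le_of_isFoot (hX : IsCATNegOne X) {A : Set X}
    (hA : IsGeodesicallyConvex A) {x a z : X} (ha : IsFoot A x a) (hz : z ∈ A) :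
    Real.cosh (dist x a) * Real.cosh (dist a z) ≤ Real.cosh (dist x z) := by
  set P := Real.cosh (dist x a)
  set L := Real.cosh (dist a z)
  set D := Real.cosh (dist x z)
  have hP : 0 < P := Real.cosh_pos _
  have hL : 0 < L := Real.cosh_pos _
  have hD : 0 < D := Real.cosh_pos _
  by_contra! hc
  -- first variation: move from `a` towards `z` by the weight `β`
  obtain ⟨β, hβ⟩ : ∃ β, β = P * (P * L - D) / D ^ 2 := ⟨_, rfl⟩
  have hβ0 : 0 < β := by
    have : 0 < P * L - D := by linarith
    rw [hβ]; positivity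
  obtain ⟨p, hp, hw⟩ := hX.exists_weighted_point a z (zero_le_one' ℝ) hβ0.le
  have h1 := hw x
  have h2 : P ≤ Real.cosh (dist x p) := cosh_le_cosh_of_le dist_nonneg (ha.2 p (hA _ ha.1 _ hz _ hp))
  have h3 : P * √(1 ^ 2 + β ^ 2 + 2 * 1 * β * L) ≤ 1 * P + β * D :=
    (mul_le_mul_of_nonneg_right h2 (Real.sqrt_nonneg _)).trans h1
  have h4 : P ^ 2 * (1 + β ^ 2 + 2 * β * L) ≤ (P + β * D) ^ 2 := by
    have := pow_le_pow_left₀ (by positivity) h3 2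
    rw [mul_pow, Real.sq_sqrt (by positivity)] at this
    linarith
  have h5 : 2 * P * (P * L - D) ≤ β * D ^ 2 := by
    have : 0 ≤ β * P ^ 2 := by positivity
    have h6 : β * (2 * P * (P * L - D)) ≤ β * (β * D ^ 2) := by nlinarith
    exact le_of_mul_le_mul_left h6 hβ0
  have h6 : β * D ^ 2 = P * (P * L - D) := by rw [hβ]; field_simp
  nlinarith [mul_pos hP (sub_pos.mpr hc)]

theorem IsCATNegOne.exists_isFoot [CompleteSpace X] (hX : IsCATNegOne X) {A : Set X}
    (hc : IsClosed A) (hne : A.Nonempty) (hA : IsGeodesicallyConvex A) (x : X) :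
    ∃ a, IsFoot A x a := by
  obtain ⟨d, hd⟩ : ∃ d, d = Metric.infDist x A := ⟨_, rfl⟩
  have hd0 : 0 ≤ d := hd ▸ Metric.infDist_nonneg
  have hmin : ∀ b ∈ A, d ≤ dist x b := fun b hb => hd ▸ Metric.infDist_le_dist_of_mem hb
  have hseq : ∀ n : ℕ, ∃ y ∈ A, dist x y < d + 1 / ((n : ℝ) + 1) := fun n => by
    have : Metric.infDist x A < d + 1 / ((n : ℝ) + 1) := by
      rw [← hd]; have : (0 : ℝ) < 1 / ((n : ℝ) + 1) := by positivity
      linarith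
    exact (Metric.infDist_lt_iff hne).mp this
  choose y hyA hy using hseq
  have hP : 0 < Real.cosh d := Real.cosh_pos d
  let b : ℕ → ℝ := fun N => √(8 * (Real.cosh (d + 1 / ((N : ℝ) + 1)) / Real.cosh d - 1))
  have hb : Filter.Tendsto b Filter.atTop (nhds 0) := by
    have h1 : Filter.Tendsto (fun N : ℕ => d + 1 / ((N : ℝ) + 1)) Filter.atTop (nhds (d + 0)) :=
      tendsto_const_nhds.add tendsto_one_div_add_atTop_nhds_zero_nat
    have h2 : ContinuousAt (fun s => √(8 * (Real.cosh s / Real.cosh d - 1))) (d + 0) := by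
      have := Real.continuous_cosh
      fun_prop
    have := h2.tendsto.comp h1
    have e : √(8 * (Real.cosh (d + 0) / Real.cosh d - 1)) = 0 := by
      rw [add_zero, div_self hP.ne', sub_self, mul_zero, Real.sqrt_zero]
    rw [e] at this
    exact this
  have hcau : CauchySeq y := by
    refine cauchySeq_of_le_tendsto_0 b (fun n m N hn hm => ?_) hb
    obtain ⟨p, hp, hw⟩ := hX.exists_weighted_point (y n) (y m) (zero_le_one' ℝ) (zero_le_one' ℝ)
    have h1 := hw x
    have hmono : ∀ k, N ≤ k → Real.cosh (dist x (y k)) ≤ Real.cosh (d + 1 / ((N : ℝ) + 1)) := by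
      intro k hk
      refine cosh_le_cosh_of_le dist_nonneg ((hy k).le.trans ?_)
      have : (N : ℝ) ≤ k := by exact_mod_cast hk
      gcongr
    have h2 : Real.cosh d ≤ Real.cosh (dist x p) :=
      cosh_le_cosh_of_le hd0 (hmin p (hA _ (hyA n) _ (hyA m) _ hp))
    set l := dist (y n) (y m)
    set T := Real.cosh (d + 1 / ((N : ℝ) + 1))
    have h3 : √(1 ^ 2 + 1 ^ 2 + 2 * 1 * 1 * Real.cosh l) = 2 * Real.cosh (l / 2) := by
      have := Real.cosh_sq (l / 2)
      have h := Real.cosh_two_mul (l / 2)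
      rw [show 2 * (l / 2) = l by ring] at h
      rw [Real.sqrt_eq_iff_mul_self_eq (by have := Real.cosh_pos l; positivity)
        (by have := Real.cosh_pos (l / 2); positivity)]
      rw [h]; linarith
    rw [h3] at h1
    have h4 : Real.cosh d * (2 * Real.cosh (l / 2)) ≤ 2 * T := by
      have := mul_le_mul_of_nonneg_right h2 (by have := Real.cosh_pos (l / 2); positivity :
        0 ≤ 2 * Real.cosh (l / 2))
      linarith [hmono n hn, hmono m hm]
    have h5 : Real.cosh (l / 2) ≤ T / Real.cosh d := by rw [le_div_iff₀ hP]; linarith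
    have h6 := one_add_sq_div_two_le_cosh (l / 2)
    apply Real.le_sqrt_of_sq_le
    nlinarith
  obtain ⟨a, ha⟩ := cauchySeq_tendsto_of_complete hcau
  have haA : a ∈ A := hc.mem_of_tendsto ha (Filter.Eventually.of_forall hyA)
  have hle : dist x a ≤ d := by
    have h1 : Filter.Tendsto (fun n : ℕ => d + 1 / ((n : ℝ) + 1)) Filter.atTop (nhds (d + 0)) :=
      tendsto_const_nhds.add tendsto_one_div_add_atTop_nhds_zero_nat
    have h2 : Filter.Tendsto (fun n => dist x (y n)) Filter.atTop (nhds (dist x a)) :=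
      tendsto_const_nhds.dist ha
    have := le_of_tendsto_of_tendsto' h2 h1 (fun n => (hy n).le)
    simpa using this
  exact ⟨a, haA, fun b hb => hle.trans (hmin b hb)⟩

/-- A quadrilateral with obtuse angles at `x'` and `y'` is at least as wide at its top as the
hyperbolic quadrilateral with right angles and the same legs and base. The proof compares the
points of the diagonals which in the hyperbolic plane are the intersection point. -/
theorem IsCATNegOne.quadrilateral (hX : IsCATNegOne X) {x y x' y' : X}
    (h1 : Real.cosh (dist x x') * Real.cosh (dist x' y') ≤ Real.cosh (dist x y'))
    (h2 : Real.cosh (dist y y') * Real.cosh (dist x' y') ≤ Real.cosh (dist y x')) :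
    Real.cosh (dist x x') * Real.cosh (dist y y') * Real.cosh (dist x' y') -
      Real.sinh (dist x x') * Real.sinh (dist y y') ≤ Real.cosh (dist x y) := by
  rcases (dist_nonneg : 0 ≤ dist x x').eq_or_lt with h0 | ha
  · rw [← h0, Real.cosh_zero, Real.sinh_zero]
    rw [← dist_eq_zero.mp h0.symm, dist_comm y x] at h2
    rw [← dist_eq_zero.mp h0.symm]
    linarith
  rcases (dist_nonneg : 0 ≤ dist y y').eq_or_lt with h0 | hb
  · rw [← h0, Real.cosh_zero, Real.sinh_zero]
    rw [← dist_eq_zero.mp h0.symm] at h1 ⊢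
    linarith
  have sa : 0 < Real.sinh (dist x x') := Real.sinh_pos_iff.mpr ha
  have sb : 0 < Real.sinh (dist y y') := Real.sinh_pos_iff.mpr hb
  have qa := Real.cosh_sq (dist x x')
  have qb := Real.cosh_sq (dist y y')
  have ca : 0 < Real.cosh (dist x x') := Real.cosh_pos _
  have cb : 0 < Real.cosh (dist y y') := Real.cosh_pos _
  have hC : 0 < Real.cosh (dist x' y') := Real.cosh_pos _
  obtain ⟨p, hp, hpw⟩ := hX.exists_weighted_point x y' sb.le (mul_pos sa cb).le
  obtain ⟨q, hq, hqw⟩ := hX.exists_weighted_point y x' sa.le (mul_pos sb ca).le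
  have k0 := hqw p
  have k1 := hpw y
  have k2 := hpw x'
  rw [dist_comm p y, dist_comm p x'] at k0
  rw [dist_comm y x] at k1
  rw [dist_comm x' x] at k2
  generalize Real.cosh (dist x x') = A at *
  generalize Real.sinh (dist x x') = a at *
  generalize Real.cosh (dist y y') = B at *
  generalize Real.sinh (dist y y') = b at *
  generalize Real.cosh (dist x' y') = C at *
  generalize Real.cosh (dist x y) = D at *
  obtain ⟨W, hW⟩ : ∃ W, W = A ^ 2 * B ^ 2 - 1 + 2 * a * b * A * B * C := ⟨_, rfl⟩
  have hW0 : 0 < W := by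
    have : W = b ^ 2 + a ^ 2 * B ^ 2 + 2 * a * b * A * B * C := by rw [hW, qa, qb]; ring
    rw [this]; positivity
  have r1 : √W ≤ √(b ^ 2 + (a * B) ^ 2 + 2 * b * (a * B) * Real.cosh (dist x y')) := by
    apply Real.sqrt_le_sqrt
    have : 2 * b * (a * B) * (A * C) ≤ 2 * b * (a * B) * Real.cosh (dist x y') := by gcongr
    have e : W = b ^ 2 + (a * B) ^ 2 + 2 * b * (a * B) * (A * C) := by rw [hW, qa, mul_pow, qb]; ring
    linarith
  have r2 : √W ≤ √(a ^ 2 + (b * A) ^ 2 + 2 * a * (b * A) * Real.cosh (dist y x')) := by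
    apply Real.sqrt_le_sqrt
    have : 2 * a * (b * A) * (B * C) ≤ 2 * a * (b * A) * Real.cosh (dist y x') := by gcongr
    have e : W = a ^ 2 + (b * A) ^ 2 + 2 * a * (b * A) * (B * C) := by rw [hW, qb, mul_pow, qa]; ring
    linarith
  have k0' : √W ≤ a * Real.cosh (dist y p) + b * A * Real.cosh (dist x' p) := by
    have := Real.one_le_cosh (dist p q)
    nlinarith [Real.sqrt_nonneg W]
  have k1' : Real.cosh (dist y p) * √W ≤ b * D + a * B * B :=
    (mul_le_mul_of_nonneg_left r1 (Real.cosh_pos _).le).trans k1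
  have k2' : Real.cosh (dist x' p) * √W ≤ b * A + a * B * C :=
    (mul_le_mul_of_nonneg_left r1 (Real.cosh_pos _).le).trans k2
  have hWW : √W * √W = W := Real.mul_self_sqrt hW0.le
  have k3 : W ≤ a * (b * D + a * B * B) + b * A * (b * A + a * B * C) := by
    have t0 := mul_le_mul_of_nonneg_right k0' (Real.sqrt_nonneg W)
    have t1 := mul_le_mul_of_nonneg_left k1' sa.le
    have t2 := mul_le_mul_of_nonneg_left k2' (mul_pos sb ca).le
    nlinarith
  have k4 : a * b * (A * B * C - a * b) ≤ a * b * D := by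
    have e1 : a ^ 2 = A ^ 2 - 1 := by linarith
    have e2 : b ^ 2 = B ^ 2 - 1 := by linarith
    have e3 : a * b * (a * b) = (A ^ 2 - 1) * (B ^ 2 - 1) := by rw [← e1, ← e2]; ring
    have e4 : a * (a * B * B) = (A ^ 2 - 1) * B ^ 2 := by rw [← e1]; ring
    have e5 : b * A * (b * A) = (B ^ 2 - 1) * A ^ 2 := by rw [← e2]; ring
    nlinarith
  exact le_of_mul_le_mul_left k4 (mul_pos sa sb)

end CAT

/-! ### Projections to convex sets and thin triangles -/

section CAT

variable {X : Type*} [MetricSpace X]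

theorem IsCATNegOne.cosh_mul_cosh_mul_le_of_isFoot (hX : IsCATNegOne X) {A : Set X}
    (hA : IsGeodesicallyConvex A) {x y x' y' : X} (hx : IsFoot A x x') (hy : IsFoot A y y') :
    Real.cosh (dist x x') * Real.cosh (dist y y') * (Real.cosh (dist x' y') - 1) ≤
      Real.cosh (dist x y) - 1 := by
  have h1 := hX.cosh_mul_cosh_le_of_isFoot hA hx hy.1
  have h2 := hX.cosh_mul_cosh_le_of_isFoot hA hy hx.1
  rw [dist_comm y' x'] at h2
  have h3 := hX.quadrilateral h1 h2
  have h4 := Real.one_le_cosh (dist x x' - dist y y')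
  rw [Real.cosh_sub] at h4
  linarith

/-- The nearest point projection onto a convex set is `1`-Lipschitz. -/
theorem IsCATNegOne.dist_le_of_isFoot (hX : IsCATNegOne X) {A : Set X}
    (hA : IsGeodesicallyConvex A) {x y x' y' : X} (hx : IsFoot A x x') (hy : IsFoot A y y') :
    dist x' y' ≤ dist x y := by
  have h := hX.cosh_mul_cosh_mul_le_of_isFoot hA hx hy
  apply le_of_cosh_le_cosh dist_nonneg
  have h1 := Real.one_le_cosh (dist x x')
  have h2 := Real.one_le_cosh (dist y y')
  have h3 := Real.one_le_cosh (dist x' y')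
  nlinarith [mul_nonneg (sub_nonneg.mpr (one_le_mul_of_one_le_of_one_le h1 h2)) (sub_nonneg.mpr h3)]

theorem IsCATNegOne.cosh_dist_midpoint_le (hX : IsCATNegOne X) (x : X) {y z m : X}
    (h1 : dist y m = dist y z / 2) (h2 : dist m z = dist y z / 2) :
    2 * Real.cosh (dist y z / 2) * Real.cosh (dist x m) ≤
      Real.cosh (dist x y) + Real.cosh (dist x z) := by
  have key := hX.cosh_dist_mul_sinh_le x (show MetricBetween y m z by unfold MetricBetween; linarith)
  rcases (dist_nonneg : 0 ≤ dist y z).eq_or_lt with h0 | hl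
  · have e1 : y = z := dist_eq_zero.mp h0.symm
    have e2 : y = m := dist_eq_zero.mp (by rw [h1, ← h0]; simp)
    rw [← h0, ← e1, ← e2]
    simp; linarith
  · rw [h1, h2] at key
    have hs : Real.sinh (dist y z) = 2 * Real.sinh (dist y z / 2) * Real.cosh (dist y z / 2) := by
      rw [← Real.sinh_two_mul]; congr 1; ring
    have hp : 0 < Real.sinh (dist y z / 2) := Real.sinh_pos_iff.mpr (by linarith)
    rw [hs] at key
    refine le_of_mul_le_mul_right ?_ hp
    linarith

/-- The midpoints of two sides of a triangle are at most half as far apart as the endpoints of the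
third side. -/
theorem IsCATNegOne.dist_midpoint_midpoint_le (hX : IsCATNegOne X) {x y z m n : X}
    (m1 : dist x m = dist x y / 2) (m2 : dist m y = dist x y / 2)
    (n1 : dist x n = dist x z / 2) (n2 : dist n z = dist x z / 2) :
    dist m n ≤ dist y z / 2 := by
  have k := hX.cosh_dist_midpoint_le m n1 n2
  have k1 := hX.cosh_dist_midpoint_le x m1 m2
  have k2 := hX.cosh_dist_midpoint_le z m1 m2
  rw [dist_self, Real.cosh_zero] at k1
  rw [dist_comm m x, dist_comm m z] at k
  rw [dist_comm z x, dist_comm z y] at k2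
  apply le_of_cosh_le_cosh (by positivity)
  have t1 := dist_triangle x y z
  have t2 := dist_triangle y x z
  have t3 := dist_triangle x z y
  rw [dist_comm y x] at t2
  rw [dist_comm z y] at t3
  obtain ⟨a, ha⟩ : ∃ a, a = dist x y / 2 := ⟨_, rfl⟩
  obtain ⟨b, hb⟩ : ∃ b, b = dist x z / 2 := ⟨_, rfl⟩
  obtain ⟨g, hg⟩ : ∃ g, g = dist y z / 2 := ⟨_, rfl⟩
  have a0 : 0 ≤ a := ha ▸ (by positivity)
  have b0 : 0 ≤ b := hb ▸ (by positivity)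
  have g0 : 0 ≤ g := hg ▸ (by positivity)
  have ea : dist x y = 2 * a := by rw [ha]; ring
  have eb : dist x z = 2 * b := by rw [hb]; ring
  have eg : dist y z = 2 * g := by rw [hg]; ring
  rw [← hb] at k
  rw [← ha, ea] at k1
  rw [← ha, eb, eg] at k2
  rw [← hg]
  have ca := Real.cosh_pos a
  have cb := Real.cosh_pos b
  have da := Real.cosh_two_mul a
  have db := Real.cosh_two_mul b
  have dg := Real.cosh_two_mul g
  have sa := Real.cosh_sq a
  have sb := Real.cosh_sq b
  have sg := Real.cosh_sq g
  have u1 : Real.cosh g ≤ Real.cosh (a + b) := cosh_le_cosh_of_le g0 (by linarith)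
  have u2 : Real.cosh (a - b) ≤ Real.cosh g := by
    rw [Real.cosh_le_cosh, abs_of_nonneg g0, abs_le]; constructor <;> linarith
  rw [Real.cosh_add] at u1
  rw [Real.cosh_sub] at u2
  have u3 := mul_nonneg (sub_nonneg.mpr u1) (sub_nonneg.mpr u2)
  have k3 : 2 * Real.cosh a * (2 * Real.cosh b * Real.cosh (dist m n)) ≤
      1 + Real.cosh (2 * a) + Real.cosh (2 * b) + Real.cosh (2 * g) := by
    have := mul_le_mul_of_nonneg_left k (by positivity : 0 ≤ 2 * Real.cosh a)
    linarith
  have k4 : 4 * Real.cosh a * Real.cosh b * Real.cosh (dist m n) ≤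
      4 * Real.cosh a * Real.cosh b * Real.cosh g := by
    have e : Real.sinh a ^ 2 * Real.sinh b ^ 2 = (Real.cosh a ^ 2 - 1) * (Real.cosh b ^ 2 - 1) := by
      rw [sa, sb]; ring
    nlinarith
  exact le_of_mul_le_mul_left k4 (by positivity)

/-- The distance to a convex set is (midpoint) convex along geodesics. -/
theorem IsCATNegOne.dist_midpoint_foot_le (hX : IsCATNegOne X) {A : Set X}
    (hA : IsGeodesicallyConvex A) {x y m x' y' m' : X}
    (m1 : dist x m = dist x y / 2) (m2 : dist m y = dist x y / 2)
    (hx : IsFoot A x x') (hy : IsFoot A y y') (hm : IsFoot A m m') :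
    2 * dist m m' ≤ dist x x' + dist y y' := by
  have half : ∀ u v : X, ∃ w, MetricBetween u w v ∧ dist u w = dist u v / 2 ∧
      dist w v = dist u v / 2 := fun u v => by
    have : 0 ≤ dist u v := dist_nonneg
    obtain ⟨w, h0, h1, h2⟩ := hX.exists_dist_eq u v (t := dist u v / 2) (by linarith) (by linarith)
    exact ⟨w, h0, h1, by linarith⟩
  obtain ⟨n, _, n1, n2⟩ := half x y'
  obtain ⟨k, hk, k1, k2⟩ := half x' y'
  have h1 := hX.dist_midpoint_midpoint_le m1 m2 n1 n2
  have h2 := hX.dist_midpoint_midpoint_le (x := y') (y := x) (z := x') (m := n) (n := k)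
    (by rw [dist_comm, n2, dist_comm x]) (by rw [dist_comm, n1, dist_comm x])
    (by rw [dist_comm, k2, dist_comm x']) (by rw [dist_comm, k1, dist_comm x'])
  have h3 := hm.2 k (hA _ hx.1 _ hy.1 _ hk)
  linarith [dist_triangle m n k]

/-- A parametrization by arc length of the segment from `x` to `y`, which covers all points that are
metrically between `x` and `y`. -/
theorem IsCATNegOne.exists_param (hX : IsCATNegOne X) (x y : X) :
    ∃ γ : ℝ → X, γ 0 = x ∧ γ (dist x y) = y ∧
      (∀ s ∈ Set.Icc 0 (dist x y), ∀ t ∈ Set.Icc 0 (dist x y), dist (γ s) (γ t) = |s - t|) ∧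
      (∀ t ∈ Set.Icc 0 (dist x y), MetricBetween x (γ t) y) ∧
      (∀ p, MetricBetween x p y → dist x p ∈ Set.Icc 0 (dist x y) ∧ p = γ (dist x p)) := by
  obtain ⟨γ, g0, g1, hγ⟩ := hX.geodesic x y
  have e1 : ∀ t ∈ Set.Icc 0 (dist x y), dist x (γ t) = t := fun t ht => by
    have := hγ 0 ⟨le_rfl, dist_nonneg⟩ t ht
    rw [g0, zero_sub, abs_neg, abs_of_nonneg ht.1] at this
    exact this
  have e2 : ∀ t ∈ Set.Icc 0 (dist x y), MetricBetween x (γ t) y := fun t ht => by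
    have := hγ t ht _ ⟨dist_nonneg, le_rfl⟩
    rw [g1, abs_sub_comm, abs_of_nonneg (by linarith [ht.2])] at this
    unfold MetricBetween
    rw [e1 t ht, this]; ring
  refine ⟨γ, g0, g1, hγ, e2, fun p hp => ?_⟩
  have hp' : dist x p + dist p y = dist x y := hp
  have hI : dist x p ∈ Set.Icc 0 (dist x y) :=
    ⟨dist_nonneg, by linarith [dist_nonneg (x := p) (y := y)]⟩
  exact ⟨hI, hX.eq_of_metricBetween hp (e2 _ hI) (e1 _ hI).symm⟩

/-- The geodesic segment between two points. -/
def geodesicSegment (x y : X) : Set X := {p | MetricBetween x p y}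

theorem IsCATNegOne.geodesicSegment_convex (hX : IsCATNegOne X) (x y : X) :
    IsGeodesicallyConvex (geodesicSegment x y) := by
  obtain ⟨γ, -, -, hγ, hb, hu⟩ := hX.exists_param x y
  have main : ∀ s ∈ Set.Icc 0 (dist x y), ∀ t ∈ Set.Icc 0 (dist x y), s ≤ t →
      ∀ p, MetricBetween (γ s) p (γ t) → MetricBetween x p y := by
    intro s hs t ht hst p hp
    have d1 : dist (γ s) (γ t) = t - s := by rw [hγ s hs t ht, abs_sub_comm, abs_of_nonneg]; linarith
    have hp' : dist (γ s) p + dist p (γ t) = dist (γ s) (γ t) := hp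
    have n1 : 0 ≤ dist (γ s) p := dist_nonneg
    have n2 : 0 ≤ dist p (γ t) := dist_nonneg
    have hr : s + dist (γ s) p ∈ Set.Icc 0 (dist x y) := ⟨by linarith [hs.1], by linarith [ht.2]⟩
    have d2 : dist (γ s) (γ (s + dist (γ s) p)) = dist (γ s) p := by
      rw [hγ s hs _ hr, abs_sub_comm, abs_of_nonneg] <;> linarith
    have d3 : dist (γ (s + dist (γ s) p)) (γ t) = t - s - dist (γ s) p := by
      rw [hγ _ hr t ht, abs_sub_comm, abs_of_nonneg] <;> linarith
    have := hX.eq_of_metricBetween hp (q := γ (s + dist (γ s) p))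
      (by unfold MetricBetween; rw [d2, d3, d1]; ring) d2.symm
    rw [this]
    exact hb _ hr
  intro u hu' v hv' p hp
  obtain ⟨iu, eu⟩ := hu u hu'
  obtain ⟨iv, ev⟩ := hu v hv'
  rcases le_total (dist x u) (dist x v) with h | h
  · exact main _ iu _ iv h p (by rw [← eu, ← ev]; exact hp)
  · exact main _ iv _ iu h p (by rw [← eu, ← ev]; exact hp.symm)

theorem geodesicSegment_isClosed (x y : X) : IsClosed (geodesicSegment x y) := by
  unfold geodesicSegment MetricBetween
  exact isClosed_eq (by fun_prop) continuous_const

theorem IsCATNegOne.geodesicSegment_isCompact (hX : IsCATNegOne X) (x y : X) :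
    IsCompact (geodesicSegment x y) := by
  obtain ⟨γ, -, -, hγ, hb, hu⟩ := hX.exists_param x y
  have : geodesicSegment x y = γ '' Set.Icc 0 (dist x y) := by
    ext p
    constructor
    · intro hp
      exact ⟨_, (hu p hp).1, (hu p hp).2.symm⟩
    · rintro ⟨t, ht, rfl⟩
      exact hb t ht
  rw [this]
  apply isCompact_Icc.image_of_continuousOn
  rw [Metric.continuousOn_iff]
  intro b hb' e he
  refine ⟨e, he, fun a ha hab => ?_⟩
  rwa [hγ a ha b hb']

/-- A point that almost realizes the triangle equality is close to the segment. -/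
theorem IsCATNegOne.exists_near_of_almost_between (hX : IsCATNegOne X) {x w z : X} {k : ℝ}
    (h : dist x w + dist w z ≤ dist x z + 2 * k) :
    ∃ q, MetricBetween x q z ∧ Real.cosh (dist w q) ≤ 2 * Real.exp k := by
  -- weights that balance the distances of `w` to both ends
  obtain ⟨q, hq, hw⟩ := hX.exists_weighted_point x z (Real.exp_pos (dist w z)).le
    (Real.exp_pos (dist w x)).le
  refine ⟨q, hq, ?_⟩
  have h1 := hw w
  rw [dist_comm x w] at h
  have cle : ∀ t : ℝ, 0 ≤ t → Real.cosh t ≤ Real.exp t := fun t ht => by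
    rw [Real.cosh_eq]
    have : Real.exp (-t) ≤ Real.exp t := Real.exp_le_exp.mpr (by linarith)
    linarith
  have h2 : Real.exp (dist w z) * Real.cosh (dist w x) + Real.exp (dist w x) * Real.cosh (dist w z)
      ≤ 2 * Real.exp (dist w x + dist w z) := by
    rw [Real.exp_add]
    nlinarith [cle (dist w x) dist_nonneg, cle (dist w z) dist_nonneg, Real.exp_pos (dist w x),
      Real.exp_pos (dist w z)]
  have h3 : Real.exp (dist w x + dist w z - k) ≤ √(Real.exp (dist w z) ^ 2 + Real.exp (dist w x) ^ 2 +
      2 * Real.exp (dist w z) * Real.exp (dist w x) * Real.cosh (dist x z)) := by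
    apply Real.le_sqrt_of_sq_le
    have c1 : Real.exp (dist x z) / 2 ≤ Real.cosh (dist x z) := by
      rw [Real.cosh_eq]; linarith [Real.exp_pos (-dist x z)]
    have c2 : Real.exp (dist w x + dist w z - 2 * k) ≤ Real.exp (dist x z) :=
      Real.exp_le_exp.mpr (by linarith)
    have c3 : Real.exp (dist w x + dist w z - k) ^ 2 = Real.exp (dist w z) * Real.exp (dist w x) *
        Real.exp (dist w x + dist w z - 2 * k) := by
      rw [← Real.exp_nat_mul, ← Real.exp_add, ← Real.exp_add]
      congr 1; push_cast; ring
    rw [c3]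
    have := mul_le_mul_of_nonneg_left (c2.trans (by linarith : _ ≤ 2 * Real.cosh (dist x z)))
      (mul_pos (Real.exp_pos (dist w z)) (Real.exp_pos (dist w x))).le
    nlinarith [sq_nonneg (Real.exp (dist w z)), sq_nonneg (Real.exp (dist w x))]
  have h4 : Real.cosh (dist w q) * Real.exp (dist w x + dist w z - k) ≤
      2 * Real.exp (dist w x + dist w z) :=
    ((mul_le_mul_of_nonneg_left h3 (Real.cosh_pos _).le).trans h1).trans h2
  have h5 : Real.exp (dist w x + dist w z) = Real.exp (dist w x + dist w z - k) * Real.exp k := by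
    rw [← Real.exp_add]; congr 1; ring
  rw [h5] at h4
  refine le_of_mul_le_mul_right ?_ (Real.exp_pos (dist w x + dist w z - k))
  linarith

theorem IsCATNegOne.exists_near_of_foot (hX : IsCATNegOne X) {x y z u p : X}
    (hu : IsFoot (geodesicSegment x y) z u) (hp : MetricBetween x p u) :
    ∃ q, MetricBetween x q z ∧ dist p q ≤ 3 := by
  have hx : x ∈ geodesicSegment x y := metricBetween_left x y
  have h1 := hX.cosh_mul_cosh_le_of_isFoot (hX.geodesicSegment_convex x y) hu hx
  have e4 : (4 : ℝ) = Real.exp (2 * Real.log 2) := by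
    rw [mul_comm, Real.exp_mul, Real.exp_log two_pos]; norm_num
  have h2 : dist z u + dist u x ≤ dist z x + 2 * Real.log 2 := by
    rw [← Real.exp_le_exp, Real.exp_add (dist z x), ← e4, Real.exp_add]
    have b1 : ∀ t : ℝ, Real.exp t / 2 ≤ Real.cosh t := fun t => by
      rw [Real.cosh_eq]; linarith [Real.exp_pos (-t)]
    have b2 : Real.cosh (dist z x) ≤ Real.exp (dist z x) := by
      rw [Real.cosh_eq]
      have : Real.exp (-dist z x) ≤ Real.exp (dist z x) :=
        Real.exp_le_exp.mpr (by linarith [dist_nonneg (x := z) (y := x)])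
      linarith
    have b3 := mul_le_mul (b1 (dist z u)) (b1 (dist u x)) (by positivity) (Real.cosh_pos _).le
    linarith
  have hp' : dist x p + dist p u = dist x u := hp
  obtain ⟨q, hq, hc⟩ := hX.exists_near_of_almost_between (x := x) (w := p) (z := z) (k := Real.log 2)
    (by
      rw [dist_comm x u] at hp'
      have := dist_triangle p u z
      rw [dist_comm u z] at this
      rw [dist_comm x z]
      linarith)
  refine ⟨q, hq, le_of_cosh_le_cosh (by norm_num) (hc.trans ?_)⟩
  rw [Real.exp_log two_pos]
  have := one_add_sq_div_two_le_cosh 3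
  linarith

/-- Triangles are thin: the foot `u` of `z` on the side from `x` to `y` divides this side into a
part close to the side from `x` to `z` and a part close to the side from `z` to `y`. -/
theorem IsCATNegOne.exists_center [CompleteSpace X] (hX : IsCATNegOne X) (x y z : X) :
    ∃ u, MetricBetween x u y ∧ (∀ p, MetricBetween x p u → ∃ q, MetricBetween x q z ∧ dist p q ≤ 3) ∧
      (∀ p, MetricBetween u p y → ∃ q, MetricBetween z q y ∧ dist p q ≤ 3) := by
  obtain ⟨u, hu⟩ := hX.exists_isFoot (geodesicSegment_isClosed x y) ⟨x, metricBetween_left x y⟩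
    (hX.geodesicSegment_convex x y) z
  refine ⟨u, hu.1, fun p hp => hX.exists_near_of_foot hu hp, fun p hp => ?_⟩
  have e : geodesicSegment x y = geodesicSegment y x := by
    ext p; exact ⟨MetricBetween.symm, MetricBetween.symm⟩
  rw [e] at hu
  obtain ⟨q, hq, h⟩ := hX.exists_near_of_foot hu hp.symm
  exact ⟨q, hq.symm, h⟩

theorem IsCATNegOne.exists_near_of_metricBetween [CompleteSpace X] (hX : IsCATNegOne X) {x y p : X}
    (z : X) (hp : MetricBetween x p y) :
    ∃ q, (MetricBetween x q z ∨ MetricBetween z q y) ∧ dist p q ≤ 3 := by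
  obtain ⟨u, hu, h1, h2⟩ := hX.exists_center x y z
  have hp' : dist x p + dist p y = dist x y := hp
  have hu' : dist x u + dist u y = dist x y := hu
  obtain ⟨γ, -, -, hγ, -, hb⟩ := hX.exists_param x y
  obtain ⟨ip, ep⟩ := hb p hp
  obtain ⟨iu, eu⟩ := hb u hu
  have hd : dist p u = |dist x p - dist x u| := by
    have := hγ _ ip _ iu
    rwa [← ep, ← eu] at this
  rcases le_total (dist x p) (dist x u) with h | h
  · rw [abs_sub_comm, abs_of_nonneg (by linarith)] at hd
    obtain ⟨q, hq, h⟩ := h1 p (by unfold MetricBetween; linarith)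
    exact ⟨q, Or.inl hq, h⟩
  · rw [abs_of_nonneg (by linarith), dist_comm] at hd
    obtain ⟨q, hq, h⟩ := h2 p (by unfold MetricBetween; linarith)
    exact ⟨q, Or.inr hq, h⟩

end CAT

/-! ### Projections of segments far from a convex set -/

theorem cosh_one_le_two : Real.cosh 1 ≤ 2 := by
  rw [Real.cosh_eq]
  have h1 := Real.exp_one_lt_d9
  have h2 : Real.exp (-1) ≤ 1 := Real.exp_le_one_iff.mpr (by norm_num)
  linarith

section CAT

variable {X : Type*} [MetricSpace X]

/-- The distance to a convex set cannot stay almost constant along a segment of length one which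
starts at its point of minimal distance `≥ ε`: otherwise projecting to the convex set would
contract the segment by a definite factor, while projecting back to the segment would almost
recover it. -/
theorem IsCATNegOne.exists_growth [CompleteSpace X] (hX : IsCATNegOne X) {ε : ℝ} (hε : 0 < ε) :
    ∃ k > 0, ∀ (A : Set X) (m x m' x' : X), IsGeodesicallyConvex A → IsFoot A m m' → IsFoot A x x' →
      dist m x = 1 → ε ≤ dist m m' →
      (∀ p, MetricBetween m p x → ∀ a ∈ A, dist m m' ≤ dist p a) → dist m m' + k ≤ dist x x' := by
  have hcε : 1 < Real.cosh ε := by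
    have := one_add_sq_div_two_le_cosh ε
    nlinarith
  have hc1 : 1 < Real.cosh 1 := by
    have := one_add_sq_div_two_le_cosh 1
    linarith
  obtain ⟨ω, hω0, hω1, hω⟩ : ∃ ω : ℝ, 0 < ω ∧ ω < 1 ∧
      1 + (Real.cosh 1 - 1) / Real.cosh ε < Real.cosh (1 - ω) := by
    have hlim : Filter.Tendsto (fun ω : ℝ => Real.cosh (1 - ω)) (nhdsWithin 0 (Set.Ioi 0))
        (nhds (Real.cosh (1 - 0))) := by
      have : Continuous fun ω : ℝ => Real.cosh (1 - ω) := by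
        have := Real.continuous_cosh
        fun_prop
      exact (this.tendsto 0).mono_left nhdsWithin_le_nhds
    have hlt : 1 + (Real.cosh 1 - 1) / Real.cosh ε < Real.cosh (1 - 0) := by
      rw [sub_zero]
      have : (Real.cosh 1 - 1) / Real.cosh ε < Real.cosh 1 - 1 :=
        div_lt_self (by linarith) hcε
      linarith
    have h1 := hlim.eventually (lt_mem_nhds hlt)
    have h2 : ∀ᶠ ω : ℝ in nhdsWithin 0 (Set.Ioi 0), ω ∈ Set.Ioo (0 : ℝ) 1 :=
      Ioo_mem_nhdsGT one_pos
    obtain ⟨ω, a, b⟩ := (h1.and h2).exists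
    exact ⟨ω, b.1, b.2, a⟩
  have hcω : 1 < Real.cosh ω := by
    have := one_add_sq_div_two_le_cosh ω
    nlinarith
  refine ⟨Real.log (Real.cosh ω), Real.log_pos hcω, ?_⟩
  intro A m x m' x' hA hm hx hd hεm hmin
  by_contra! hlt
  have hfx : dist m m' ≤ dist x x' := hmin x (metricBetween_right m x) x' hx.1
  set μ := dist m m'
  set a := dist x x'
  have hμ0 : 0 ≤ μ := dist_nonneg
  set σ := geodesicSegment m x
  have hσ : IsGeodesicallyConvex σ := hX.geodesicSegment_convex m x
  have hmfoot : IsFoot σ m' m := ⟨metricBetween_left m x, fun p hp => by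
    rw [dist_comm m' m, dist_comm m' p]
    exact hmin p hp m' hm.1⟩
  obtain ⟨xs, hxs⟩ := hX.exists_isFoot (geodesicSegment_isClosed m x) ⟨m, metricBetween_left m x⟩ hσ x'
  have h1 := hX.cosh_mul_cosh_le_of_isFoot hσ hxs (metricBetween_right m x : x ∈ σ)
  have h2 : Real.cosh μ ≤ Real.cosh (dist x' xs) := by
    apply cosh_le_cosh_of_le hμ0
    rw [dist_comm]
    exact hmin xs hxs.1 x' hx.1
  have h3 : Real.cosh (dist x' x) ≤ Real.cosh ω * Real.cosh μ := by
    have e1 : Real.cosh (dist x' x) ≤ Real.cosh (μ + Real.log (Real.cosh ω)) := by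
      apply cosh_le_cosh_of_le dist_nonneg
      rw [dist_comm]; exact hlt.le
    refine e1.trans ?_
    rw [Real.cosh_eq, Real.cosh_eq μ, neg_add, Real.exp_add, Real.exp_add, Real.exp_neg (Real.log _),
      Real.exp_log (by linarith)]
    have e2 : (Real.cosh ω)⁻¹ ≤ Real.cosh ω := (inv_le_one_of_one_le₀ hcω.le).trans hcω.le
    have := mul_le_mul_of_nonneg_left e2 (Real.exp_pos (-μ)).le
    linarith
  have h4 : Real.cosh (dist xs x) ≤ Real.cosh ω := by
    have e := Real.cosh_pos μ
    refine le_of_mul_le_mul_right ?_ e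
    have := mul_le_mul_of_nonneg_right h2 (Real.cosh_pos (dist xs x)).le
    linarith
  have h5 : dist xs x ≤ ω := le_of_cosh_le_cosh hω0.le h4
  have h6 : dist m xs ≤ dist m' x' := hX.dist_le_of_isFoot hσ hmfoot hxs
  have h7 : Real.cosh (1 - ω) ≤ Real.cosh (dist m' x') := by
    apply cosh_le_cosh_of_le (by linarith)
    linarith [dist_triangle m xs x]
  have h8 := hX.cosh_mul_cosh_mul_le_of_isFoot hA hm hx
  rw [hd] at h8
  have h9 : Real.cosh ε * (Real.cosh (dist m' x') - 1) ≤ Real.cosh 1 - 1 := by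
    refine le_trans ?_ h8
    apply mul_le_mul_of_nonneg_right _ (by linarith [Real.one_le_cosh (dist m' x')])
    have e1 : Real.cosh ε ≤ Real.cosh μ := cosh_le_cosh_of_le hε.le hεm
    have e2 := Real.one_le_cosh a
    have e3 := Real.cosh_pos ε
    calc Real.cosh ε = Real.cosh ε * 1 := (mul_one _).symm
      _ ≤ _ := mul_le_mul e1 e2 zero_le_one (Real.cosh_pos μ).le
  have h10 : Real.cosh (dist m' x') - 1 ≤ (Real.cosh 1 - 1) / Real.cosh ε := by
    rw [le_div_iff₀ (by linarith)]; linarith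
  linarith

/-- Far away from a convex set, the projection to it contracts segments exponentially. -/
theorem IsCATNegOne.dist_foot_le_exp (hX : IsCATNegOne X) {A : Set X}
    (hA : IsGeodesicallyConvex A) {x y x' y' : X} (hx : IsFoot A x x') (hy : IsFoot A y y')
    (hd : dist x y ≤ 1) {s : ℝ} (hs : 0 ≤ s) (hsx : s ≤ dist x x') :
    dist x' y' ≤ 2 * Real.exp (-(s / 2)) := by
  have h := hX.cosh_mul_cosh_mul_le_of_isFoot hA hx hy
  have h1 : Real.cosh (dist x y) ≤ 2 := (cosh_le_cosh_of_le dist_nonneg hd).trans cosh_one_le_two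
  have h2 : Real.exp s / 2 ≤ Real.cosh (dist x x') := by
    refine le_trans ?_ (cosh_le_cosh_of_le hs hsx)
    rw [Real.cosh_eq]
    linarith [Real.exp_pos (-s)]
  have h3 := one_add_sq_div_two_le_cosh (dist x' y')
  have h4 := Real.one_le_cosh (dist y y')
  have h5 : Real.exp s / 2 * (dist x' y' ^ 2 / 2) ≤ 1 := by
    have e1 : Real.exp s / 2 * 1 ≤ Real.cosh (dist x x') * Real.cosh (dist y y') :=
      mul_le_mul h2 h4 zero_le_one (Real.cosh_pos _).le
    have e2 : Real.exp s / 2 * 1 * (dist x' y' ^ 2 / 2) ≤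
        Real.cosh (dist x x') * Real.cosh (dist y y') * (Real.cosh (dist x' y') - 1) :=
      mul_le_mul e1 (by linarith) (by positivity)
        (mul_pos (Real.cosh_pos _) (Real.cosh_pos _)).le
    linarith
  have h6 : (2 * Real.exp (-(s / 2))) ^ 2 * Real.exp s = 4 := by
    rw [mul_pow, ← Real.exp_nat_mul, mul_assoc, ← Real.exp_add]
    rw [show ((2 : ℕ) : ℝ) * -(s / 2) + s = 0 by push_cast; ring, Real.exp_zero]
    norm_num
  refine (sq_le_sq₀ dist_nonneg (by positivity)).mp ?_
  have := Real.exp_pos s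
  refine le_of_mul_le_mul_right ?_ this
  rw [h6]
  linarith

open Classical in
/-- The nearest point projection to `A`, with junk value where no nearest point exists. -/
noncomputable def foot (A : Set X) (x : X) : X := if h : ∃ a, IsFoot A x a then h.choose else x

theorem IsCATNegOne.isFoot_foot [CompleteSpace X] (hX : IsCATNegOne X) {A : Set X}
    (hc : IsClosed A) (hne : A.Nonempty) (hA : IsGeodesicallyConvex A) (x : X) :
    IsFoot A x (foot A x) := by
  have h := hX.exists_isFoot hc hne hA x
  rw [foot, dif_pos h]
  exact h.choose_spec

/-- The image, under the projection to a convex set, of a segment which starts at its point of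
minimal distance `≥ ε` to this set can be traversed in a bounded number of steps of size `δ`. -/
theorem IsCATNegOne.exists_chain_bound_of_min [CompleteSpace X] (hX : IsCATNegOne X) {ε δ : ℝ}
    (hε : 0 < ε) (hδ : 0 < δ) : ∃ M : ℕ, ∀ (A : Set X) (m y : X), IsClosed A → A.Nonempty →
      IsGeodesicallyConvex A → ε ≤ dist m (foot A m) →
      (∀ p, MetricBetween m p y → ∀ a ∈ A, dist m (foot A m) ≤ dist p a) →
      ∃ p : ℕ → X, p 0 = m ∧ p M = y ∧ (∀ i, MetricBetween m (p i) y) ∧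
        ∀ i < M, dist (foot A (p i)) (foot A (p (i + 1))) ≤ δ := by
  obtain ⟨k, hk, hgrow⟩ := hX.exists_growth hε
  obtain ⟨q, hq⟩ : ∃ q, q = Real.exp (-(k / 2)) := ⟨_, rfl⟩
  have hq0 : 0 < q := hq ▸ Real.exp_pos _
  have hq1 : q < 1 := by rw [hq, Real.exp_lt_one_iff]; linarith
  have h1q : 0 < 1 - q := by linarith
  -- beyond length `J` the projection contracts so much that one step suffices; the part up to `J`
  -- is divided into `P` steps
  obtain ⟨J, hJ⟩ : ∃ J : ℕ, q ^ J < δ * (1 - q) / 2 :=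
    exists_pow_lt_of_lt_one (by positivity) hq1
  obtain ⟨P, hP⟩ : ∃ P : ℕ, (J : ℝ) / δ ≤ P := exists_nat_ge _
  refine ⟨P + 1, ?_⟩
  intro A m y hc hne hA hεm hmin
  have hf : ∀ x, IsFoot A x (foot A x) := fun x => hX.isFoot_foot hc hne hA x
  obtain ⟨γ, g0, g1, hγ, hb, hu⟩ := hX.exists_param m y
  set l := dist m y
  have hl : 0 ≤ l := dist_nonneg
  -- linear growth of the distance
  have hconv : ∀ i : ℕ, ((i + 1 : ℕ) : ℝ) ≤ l →
      dist (γ i) (foot A (γ i)) + k ≤ dist (γ (i + 1 : ℕ)) (foot A (γ (i + 1 : ℕ))) := by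
    intro i
    induction i with
    | zero =>
      intro h
      have h1 : (1 : ℝ) ≤ l := by simpa using h
      have hI : (1 : ℝ) ∈ Set.Icc 0 l := ⟨zero_le_one, h1⟩
      simp only [Nat.cast_zero, zero_add, Nat.cast_one]
      rw [g0]
      have hd : dist m (γ 1) = 1 := by
        have := hγ 0 ⟨le_rfl, hl⟩ 1 hI
        rw [g0] at this; simpa using this
      refine hgrow A m (γ 1) _ _ hA (hf _) (hf _) hd hεm (fun p hp => hmin p ?_)
      exact hX.geodesicSegment_convex m y m (metricBetween_left m y) _ (hb 1 hI) p hp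
    | succ i ih =>
      intro h
      have hi : ((i + 1 : ℕ) : ℝ) ≤ l := by push_cast at h ⊢; linarith
      have ih' := ih hi
      have I0 : ((i : ℕ) : ℝ) ∈ Set.Icc 0 l := ⟨by positivity, by push_cast at hi; linarith⟩
      have I1 : ((i + 1 : ℕ) : ℝ) ∈ Set.Icc 0 l := ⟨by positivity, hi⟩
      have I2 : ((i + 1 + 1 : ℕ) : ℝ) ∈ Set.Icc 0 l := ⟨by positivity, h⟩
      have d1 := hγ _ I0 _ I1
      have d2 := hγ _ I1 _ I2
      have d3 := hγ _ I0 _ I2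
      have e1 : |((i : ℕ) : ℝ) - ((i + 1 : ℕ) : ℝ)| = 1 := by
        push_cast; rw [abs_sub_comm, abs_of_nonneg] <;> linarith
      have e2 : |((i + 1 : ℕ) : ℝ) - ((i + 1 + 1 : ℕ) : ℝ)| = 1 := by
        push_cast; rw [abs_sub_comm, abs_of_nonneg] <;> linarith
      have e3 : |((i : ℕ) : ℝ) - ((i + 1 + 1 : ℕ) : ℝ)| = 2 := by
        push_cast; rw [abs_sub_comm, abs_of_nonneg] <;> linarith
      have := hX.dist_midpoint_foot_le hA (x := γ i) (y := γ (i + 1 + 1 : ℕ)) (m := γ (i + 1 : ℕ))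
        (by rw [d1, d3, e1, e3]; norm_num) (by rw [d2, d3, e2, e3]; norm_num) (hf _) (hf _) (hf _)
      linarith
  have hlin : ∀ i : ℕ, (i : ℝ) ≤ l → k * i ≤ dist (γ i) (foot A (γ i)) := by
    intro i
    induction i with
    | zero => intro _; simp
    | succ i ih =>
      intro h
      have := hconv i h
      have := ih (by push_cast at h; linarith)
      have e : k * ((i + 1 : ℕ) : ℝ) = k * i + k := by push_cast; ring
      rw [e]
      linarith
  have hstep : ∀ i : ℕ, (i : ℝ) ≤ l → ∀ t ∈ Set.Icc 0 l, |i - t| ≤ 1 →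
      dist (foot A (γ i)) (foot A (γ t)) ≤ 2 * q ^ i := by
    intro i hi t ht hit
    have := hX.dist_foot_le_exp hA (hf (γ i)) (hf (γ t))
      (by rw [hγ _ ⟨by positivity, hi⟩ _ ht]; exact hit)
      (by positivity) (hlin i hi)
    refine this.trans (le_of_eq ?_)
    rw [hq, ← Real.exp_nat_mul]; congr 2; ring
  have htail : ∀ j : ℕ, ((J + j : ℕ) : ℝ) ≤ l →
      dist (foot A (γ J)) (foot A (γ (J + j : ℕ))) ≤ 2 * q ^ J * (1 - q ^ j) / (1 - q) := by
    intro j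
    induction j with
    | zero => intro _; simp
    | succ j ih =>
      intro h
      have h' : ((J + j : ℕ) : ℝ) ≤ l := by push_cast at h ⊢; linarith
      have e1 := ih h'
      have e2 := hstep (J + j) h' ((J + (j + 1) : ℕ) : ℝ) ⟨by positivity, h⟩ (by
        push_cast; rw [abs_sub_comm, abs_of_nonneg] <;> linarith)
      refine (dist_triangle _ _ _).trans ((add_le_add e1 e2).trans (le_of_eq ?_))
      field_simp
      ring
  have hend : (J : ℝ) ≤ l → dist (foot A (γ J)) (foot A y) ≤ δ := by
    intro hJl
    obtain ⟨j, hj⟩ : ∃ j : ℕ, j = ⌊l⌋₊ - J := ⟨_, rfl⟩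
    have hfl : J ≤ ⌊l⌋₊ := Nat.le_floor hJl
    have hj' : J + j = ⌊l⌋₊ := by omega
    have h1 : ((J + j : ℕ) : ℝ) ≤ l := by rw [hj']; exact Nat.floor_le hl
    have h2 : l < ((J + j : ℕ) : ℝ) + 1 := by rw [hj']; exact Nat.lt_floor_add_one l
    have e1 := htail j h1
    have e2 := hstep (J + j) h1 l ⟨hl, le_rfl⟩ (by
      rw [abs_sub_comm, abs_of_nonneg] <;> linarith)
    rw [g1] at e2
    refine (dist_triangle _ _ _).trans ((add_le_add e1 e2).trans ?_)
    have e3 : 2 * q ^ J * (1 - q ^ j) / (1 - q) + 2 * q ^ (J + j) =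
        2 * q ^ J * (1 - q ^ (j + 1)) / (1 - q) := by
      field_simp; ring
    rw [e3, div_le_iff₀ h1q]
    have e4 : 0 < q ^ (j + 1) := by positivity
    have e5 : 0 < q ^ J := by positivity
    nlinarith
  have hmem : ∀ i : ℕ, min ((i : ℝ) * δ) (min J l) ∈ Set.Icc 0 l := fun i =>
    ⟨by positivity, (min_le_right _ _).trans (min_le_right _ _)⟩
  refine ⟨fun i => if i ≤ P then γ (min (i * δ) (min J l)) else y, ?_, ?_, ?_, ?_⟩
  · have : min 0 (min (J : ℝ) l) = 0 := min_eq_left (by positivity)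
    simp [this, g0]
  · simp
  · intro i
    dsimp only
    split_ifs
    · exact hb _ (hmem i)
    · exact metricBetween_right m y
  · intro i hi
    dsimp only
    rw [if_pos (by omega : i ≤ P)]
    by_cases hiP : i + 1 ≤ P
    · rw [if_pos hiP]
      refine (hX.dist_le_of_isFoot hA (hf _) (hf _)).trans ?_
      rw [hγ _ (hmem i) _ (hmem (i + 1))]
      refine (abs_min_sub_min_le_max _ _ _ _).trans ?_
      rw [sub_self, abs_zero, max_eq_left (abs_nonneg _)]
      push_cast
      rw [show (i : ℝ) * δ - (i + 1) * δ = -δ by ring, abs_neg, abs_of_pos hδ]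
    · rw [if_neg hiP]
      have : i = P := by omega
      subst this
      have hJP : (J : ℝ) ≤ i * δ := by rwa [div_le_iff₀ hδ] at hP
      rw [min_eq_right ((min_le_left _ _).trans hJP)]
      rcases le_total (J : ℝ) l with h | h
      · rw [min_eq_left h]; exact hend h
      · rw [min_eq_right h, g1, dist_self]; exact hδ.le

/-- The projection to a convex set `A` of a segment at distance at least `ε` from `A`
can be traversed in a bounded number of steps of size `δ`. -/
theorem IsCATNegOne.exists_chain_bound [CompleteSpace X] (hX : IsCATNegOne X) {ε δ : ℝ}
    (hε : 0 < ε) (hδ : 0 < δ) : ∃ M : ℕ, ∀ (A : Set X) (x y : X), IsClosed A → A.Nonempty →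
      IsGeodesicallyConvex A → (∀ p, MetricBetween x p y → ∀ a ∈ A, ε ≤ dist p a) →
      ∃ p : ℕ → X, p 0 = x ∧ p M = y ∧ (∀ i, MetricBetween x (p i) y) ∧
        ∀ i < M, dist (foot A (p i)) (foot A (p (i + 1))) ≤ δ := by
  obtain ⟨M, hM⟩ := hX.exists_chain_bound_of_min hε hδ
  refine ⟨M + M, ?_⟩
  intro A x y hc hne hA hfar
  have hf : ∀ x, IsFoot A x (foot A x) := fun x => hX.isFoot_foot hc hne hA x
  obtain ⟨m, hm, hmin⟩ := (hX.geodesicSegment_isCompact x y).exists_isMinOn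
    ⟨x, metricBetween_left x y⟩ (Metric.continuous_infDist_pt A).continuousOn
  have hinf : ∀ p, Metric.infDist p A = dist p (foot A p) := fun p =>
    le_antisymm (Metric.infDist_le_dist_of_mem (hf p).1)
      ((Metric.le_infDist hne).mpr fun b hb => (hf p).2 b hb)
  have hmin' : ∀ p, MetricBetween x p y → ∀ a ∈ A, dist m (foot A m) ≤ dist p a := fun p hp a ha => by
    rw [← hinf]
    exact (hmin hp).trans (Metric.infDist_le_dist_of_mem ha)
  have hsub : ∀ u, MetricBetween x u y → ∀ v, MetricBetween x v y → ∀ p, MetricBetween u p v →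
      MetricBetween x p y := fun u hu v hv p hp => hX.geodesicSegment_convex x y u hu v hv p hp
  have hεm := hfar m hm _ (hf m).1
  obtain ⟨p, p0, p1, pb, ps⟩ := hM A m x hc hne hA hεm
    (fun p hp => hmin' p (hsub _ hm _ (metricBetween_left x y) p hp))
  obtain ⟨r, r0, r1, rb, rs⟩ := hM A m y hc hne hA hεm
    (fun p hp => hmin' p (hsub _ hm _ (metricBetween_right x y) p hp))
  refine ⟨fun i => if i ≤ M then p (M - i) else r (i - M), ?_, ?_, ?_, ?_⟩
  · simp [p1]
  · by_cases h : M = 0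
    · subst h; simp [p0, ← r1, r0]
    · have : ¬ M + M ≤ M := by omega
      simp [h, r1]
  · intro i
    dsimp only
    split_ifs
    · exact hsub _ hm _ (metricBetween_left x y) _ (pb _)
    · exact hsub _ hm _ (metricBetween_right x y) _ (rb _)
  · intro i hi
    dsimp only
    rcases lt_trichotomy i M with h | h | h
    · rw [if_pos (by omega), if_pos (by omega), dist_comm]
      have := ps (M - (i + 1)) (by omega)
      rwa [show M - (i + 1) + 1 = M - i by omega] at this
    · subst h
      rw [if_pos le_rfl, if_neg (by omega), Nat.sub_self, p0, ← r0]
      have := rs 0 (by omega)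
      simpa using this
    · rw [if_neg (by omega), if_neg (by omega)]
      have := rs (i - M) (by omega)
      rwa [show i - M + 1 = i + 1 - M by omega] at this

end CAT

/-! ### A criterion for hyperbolicity -/

/-- Exponentials beat linear functions, in the form that bounds a distance `m` once it is known to
be at most logarithmic in `8 * m + 2 * D`. -/
theorem exists_bound_of_log_growth (D : ℕ) :
    ∃ M : ℕ, ∀ m, M < m → ∃ k, 8 * m + 2 * D ≤ 2 ^ k ∧ D * (k + 1) < m := by
  refine ⟨2 * (D + 1) * (18 * (D + 1) + 2), fun m hm => ?_⟩
  obtain ⟨s, hs⟩ : ∃ s, s = m / (2 * (D + 1)) := ⟨_, rfl⟩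
  have h1 : 2 * (D + 1) * s ≤ m := hs ▸ Nat.mul_div_le m _
  have h2 : m < 2 * (D + 1) * (s + 1) := hs ▸ Nat.lt_mul_div_succ m (by omega)
  have h3 : 18 * (D + 1) + 2 ≤ s := by
    rw [hs, Nat.le_div_iff_mul_le (by omega)]
    linarith
  obtain ⟨j, rfl⟩ : ∃ j, s = j + 1 := ⟨s - 1, by omega⟩
  refine ⟨j + j, ?_, by nlinarith⟩
  have h4 : j + 2 ≤ 2 ^ j := by
    have : ∀ n : ℕ, n + 4 ≤ 2 ^ (n + 2) := by
      intro n
      induction n with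
      | zero => norm_num
      | succ n ih => rw [show n + 1 + 2 = n + 2 + 1 by ring, pow_succ]; omega
    have := this (j - 2)
    rw [show j - 2 + 2 = j by omega] at this
    omega
  have h5 : 18 * (D + 1) ≤ 2 ^ j := by
    have := (Nat.lt_two_pow_self (n := j)).le
    omega
  rw [pow_add]
  calc 8 * m + 2 * D ≤ 18 * (D + 1) * (j + 2) := by nlinarith
    _ ≤ _ := Nat.mul_le_mul h5 h4

namespace SimpleGraph

variable {V : Type*} {K : SimpleGraph V}

theorem Walk.dist_le_length_of_mem_support {u v w : V} (p : K.Walk u v) (hw : w ∈ p.support) :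
    K.dist u w ≤ p.length := by
  classical
  exact (dist_le (p.takeUntil w hw)).trans (p.length_takeUntil_le_length hw)

theorem Walk.dist_add_dist_le_length {u v w : V} (p : K.Walk u v) (hw : w ∈ p.support) :
    K.dist u w + K.dist w v ≤ p.length := by
  classical
  have h := congrArg Walk.length (p.take_spec hw)
  rw [Walk.length_append] at h
  have h1 := dist_le (p.takeUntil w hw)
  have h2 := dist_le (p.dropUntil w hw)
  omega

/-- Two vertices of a geodesic walk are joined by a geodesic part of this walk. -/
theorem Walk.exists_subwalk {u v a b : V} (p : K.Walk u v) (hp : p.length = K.dist u v)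
    (hconn : K.Connected) (ha : a ∈ p.support) (hb : b ∈ p.support) :
    ∃ w : K.Walk a b, w.length ≤ K.dist a b ∧ w.support ⊆ p.support := by
  classical
  have h1 := congrArg Walk.length (p.take_spec ha)
  rw [Walk.length_append] at h1
  have h2 := dist_le (p.takeUntil a ha)
  have h3 := dist_le (p.dropUntil a ha)
  by_cases h : b ∈ (p.dropUntil a ha).support
  · refine ⟨(p.dropUntil a ha).takeUntil b h, ?_, ?_⟩
    · have h4 := congrArg Walk.length ((p.dropUntil a ha).take_spec h)
      rw [Walk.length_append] at h4
      have t1 := hconn.dist_triangle (u := u) (v := a) (w := v)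
      have t2 := hconn.dist_triangle (u := a) (v := b) (w := v)
      have h5 := dist_le ((p.dropUntil a ha).dropUntil b h)
      omega
    · exact fun z hz => p.support_dropUntil_subset_support ha
        ((p.dropUntil a ha).support_takeUntil_subset_support h hz)
  · have h' : b ∈ (p.takeUntil a ha).support := by
      have : b ∈ ((p.takeUntil a ha).append (p.dropUntil a ha)).support := by
        rw [p.take_spec ha]; exact hb
      rw [Walk.mem_support_append_iff] at this
      exact this.resolve_right h
    refine ⟨((p.takeUntil a ha).dropUntil b h').reverse, ?_, ?_⟩
    · have h4 := congrArg Walk.length ((p.takeUntil a ha).take_spec h')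
      rw [Walk.length_append] at h4
      have t1 := hconn.dist_triangle (u := u) (v := a) (w := v)
      have t2 := hconn.dist_triangle (u := u) (v := b) (w := a)
      have h5 := dist_le ((p.takeUntil a ha).takeUntil b h')
      rw [Walk.length_reverse, dist_comm]
      omega
    · rw [Walk.support_reverse]
      intro z hz
      exact p.support_takeUntil_subset_support ha
        ((p.takeUntil a ha).support_dropUntil_subset_support h' (List.mem_reverse.mp hz))

end SimpleGraph

/-- A graph `K` which coarsely models a geodesic space `X`: a vertex `v` represents the points `x`
with `rep x v`, the vertex `proj x` is one of the vertices that represent `x`, points at distance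
at most `3` are represented by vertices at distance at most `D`, and a geodesic of `X` between
points represented by equal or adjacent vertices stays `D`-close to these vertices. -/
structure CoarseGraphModel (X : Type*) [MetricSpace X] {V : Type*} (K : SimpleGraph V) where
  /-- the relation that a point is represented by a vertex -/
  rep : X → V → Prop
  /-- a vertex representing a given point -/
  proj : X → V
  /-- the constant of the coarse estimates -/
  D : ℕ
  connected : K.Connected
  rep_proj : ∀ x, rep x (proj x)
  exists_rep : ∀ v, ∃ x, rep x v
  dist_proj_le : ∀ x y, dist x y ≤ 3 → K.dist (proj x) (proj y) ≤ D
  dist_between_le : ∀ v w x y q, rep x v → rep y w → (v = w ∨ K.Adj v w) → MetricBetween x q y →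
    K.dist (proj q) v ≤ D

namespace CoarseGraphModel

variable {X V : Type*} [MetricSpace X] {K : SimpleGraph V}
  (c : CoarseGraphModel X K)

/-- A segment of `X` is logarithmically close to any walk of `K` with the same ends. -/
theorem exists_dist_le_of_walk [CompleteSpace X] (hX : IsCATNegOne X) (k : ℕ) :
    ∀ {v w : V} (p : K.Walk v w), p.length ≤ 2 ^ k →
    ∀ {x y q : X}, c.rep x v → c.rep y w → MetricBetween x q y →
      ∃ u ∈ p.support, K.dist (c.proj q) u ≤ c.D * (k + 1) := by
  induction k with
  | zero =>
    intro v w p hp x y q hx hy hq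
    refine ⟨v, p.start_mem_support, ?_⟩
    have : v = w ∨ K.Adj v w := by
      rcases Nat.lt_or_ge p.length 1 with h | h
      · exact Or.inl (SimpleGraph.Walk.eq_of_length_eq_zero (p := p) (by omega))
      · exact Or.inr (SimpleGraph.Walk.adj_of_length_eq_one (p := p) (by simp at hp; omega))
    simpa using c.dist_between_le v w x y q hx hy this hq
  | succ k ih =>
    intro v w p hp x y q hx hy hq
    obtain ⟨z, hz⟩ := c.exists_rep (p.getVert (2 ^ k))
    obtain ⟨q', hq', hd⟩ := hX.exists_near_of_metricBetween z hq
    have h1 := c.dist_proj_le q q' hd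
    have hsupp := congrArg SimpleGraph.Walk.support (p.append_take_drop_eq (2 ^ k))
    have fin : ∀ u, K.dist (c.proj q') u ≤ c.D * (k + 1) →
        K.dist (c.proj q) u ≤ c.D * (k + 1 + 1) := fun u hu => by
      have := c.connected.dist_triangle (u := c.proj q) (v := c.proj q') (w := u)
      rw [mul_add c.D (k + 1) 1]
      omega
    rcases hq' with h | h
    · obtain ⟨u, hu, hu'⟩ := ih (p.take (2 ^ k))
        (by rw [SimpleGraph.Walk.take_length]; exact min_le_left _ _)
        hx hz h
      refine ⟨u, ?_, fin u hu'⟩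
      rw [← hsupp, SimpleGraph.Walk.mem_support_append_iff]
      exact Or.inl hu
    · obtain ⟨u, hu, hu'⟩ := ih (p.drop (2 ^ k)) (by
        rw [SimpleGraph.Walk.drop_length]; rw [pow_succ] at hp; omega) hz hy h
      refine ⟨u, ?_, fin u hu'⟩
      rw [← hsupp, SimpleGraph.Walk.mem_support_append_iff]
      exact Or.inr hu

/-- Walking along a segment towards `x`, one meets a point whose distance in `K` from the start is
approximately `N`, or one arrives at `x`. -/
theorem exists_between_dist (hX : IsCATNegOne X) (x q : X) (N : ℕ) : ∃ z, MetricBetween x z q ∧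
    K.dist (c.proj z) (c.proj q) ≤ N + c.D ∧ (N ≤ K.dist (c.proj z) (c.proj q) ∨ z = x) := by
  obtain ⟨γ, g0, g1, hγ, hb, -⟩ := hX.exists_param q x
  have hl : 0 ≤ dist q x := dist_nonneg
  let t : ℕ → ℝ := fun i => min i (dist q x)
  have ht : ∀ i, t i ∈ Set.Icc 0 (dist q x) := fun i => ⟨by positivity, min_le_right _ _⟩
  have hex : ∃ i, N ≤ K.dist (c.proj (γ (t i))) (c.proj q) ∨ γ (t i) = x := by
    obtain ⟨i, hi⟩ := exists_nat_ge (dist q x)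
    exact ⟨i, Or.inr (by simp only [t]; rw [min_eq_right hi, g1])⟩
  classical
  obtain ⟨i, hi⟩ : ∃ i, i = Nat.find hex := ⟨_, rfl⟩
  refine ⟨γ (t i), (hb _ (ht i)).symm, ?_, hi ▸ Nat.find_spec hex⟩
  rcases Nat.eq_zero_or_pos i with h0 | h0
  · have : t i = 0 := by simp only [t]; rw [h0, Nat.cast_zero, min_eq_left hl]
    rw [this, g0, SimpleGraph.dist_self]
    omega
  · have h1 := Nat.find_min hex (m := i - 1) (by omega)
    push Not at h1
    have h2 : K.dist (c.proj (γ (t i))) (c.proj (γ (t (i - 1)))) ≤ c.D := by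
      apply c.dist_proj_le
      rw [hγ _ (ht i) _ (ht (i - 1))]
      refine (abs_min_sub_min_le_max _ _ _ _).trans ?_
      rw [sub_self, abs_zero, max_eq_left (abs_nonneg _), Nat.cast_sub h0]
      norm_num
    have := c.connected.dist_triangle (u := c.proj (γ (t i))) (v := c.proj (γ (t (i - 1))))
      (w := c.proj q)
    omega

theorem exists_dist_proj_le (hX : IsCATNegOne X) (R : ℝ) : ∃ B : ℕ, ∀ x y : X, dist x y ≤ R →
    K.dist (c.proj x) (c.proj y) ≤ B := by
  have main : ∀ n : ℕ, ∀ x y : X, dist x y ≤ 3 * n → K.dist (c.proj x) (c.proj y) ≤ c.D * n := by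
    intro n
    induction n with
    | zero =>
      intro x y h
      have : x = y := dist_le_zero.mp (by simpa using h)
      simp [this]
    | succ n ih =>
      intro x y h
      push_cast at h
      obtain ⟨z, -, h1, h2⟩ := hX.exists_dist_eq x y (t := min 3 (dist x y)) (by positivity)
        (min_le_right _ _)
      have e1 := c.dist_proj_le x z (h1 ▸ min_le_left _ _)
      have e2 := ih z y (by
        rw [h2]
        rcases le_total 3 (dist x y) with h3 | h3
        · rw [min_eq_left h3]; linarith
        · rw [min_eq_right h3, sub_self]; positivity)
      have := c.connected.dist_triangle (u := c.proj x) (v := c.proj z) (w := c.proj y)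
      rw [mul_add]
      omega
  obtain ⟨n, hn⟩ := exists_nat_ge (R / 3)
  exact ⟨c.D * n, fun x y h => main n x y (by linarith)⟩

/-- Segments of `X` are uniformly close to geodesics of `K`. If `q0` is a point of the segment at
maximal distance `m` from the geodesic, then the points of the segment at distance about `2 * m`
on both sides of `q0` are joined, along the geodesic, by a walk of length linear in `m` which stays
at distance `m` from `q0`; by `exists_dist_le_of_walk` this distance is logarithmic in `m`. -/
theorem exists_dist_le_of_geodesic [CompleteSpace X] (hX : IsCATNegOne X) :
    ∃ M : ℕ, ∀ {x y q : X} (α : K.Walk (c.proj x) (c.proj y)),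
    α.length = K.dist (c.proj x) (c.proj y) → MetricBetween x q y →
      ∃ a ∈ α.support, K.dist (c.proj q) a ≤ M := by
  obtain ⟨M, hM⟩ := exists_bound_of_log_growth c.D
  refine ⟨M, ?_⟩
  intro x y q α hα hq
  -- `m` is the maximal distance of a point of the segment from the geodesic
  let S : Set ℕ := {m | ∃ q, MetricBetween x q y ∧ ∀ a ∈ α.support, m ≤ K.dist (c.proj q) a}
  obtain ⟨B, hB⟩ := c.exists_dist_proj_le hX (dist x y)
  have hSne : S.Nonempty := ⟨0, q, hq, fun _ _ => Nat.zero_le _⟩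
  have hSb : BddAbove S := ⟨B, fun m ⟨p, hp, h⟩ => by
    refine (h _ α.start_mem_support).trans (hB _ _ ?_)
    have hp' : dist x p + dist p y = dist x y := hp
    rw [dist_comm]
    linarith [dist_nonneg (x := p) (y := y)]⟩
  obtain ⟨m, hm⟩ : ∃ m, m = sSup S := ⟨_, rfl⟩
  obtain ⟨q0, hq0, hfar⟩ : m ∈ S := hm ▸ Nat.sSup_mem hSne hSb
  have hnear : ∀ p, MetricBetween x p y → ∃ a ∈ α.support, K.dist (c.proj p) a ≤ m := by
    intro p hp
    by_contra! h
    have : m + 1 ∈ S := ⟨p, hp, fun a ha => h a ha⟩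
    have := le_csSup hSb this
    omega
  obtain ⟨a, ha, hqa⟩ := hnear q hq
  refine ⟨a, ha, hqa.trans ?_⟩
  by_contra! hlt
  obtain ⟨k, hk1, hk2⟩ := hM m hlt
  have hq0' : dist x q0 + dist q0 y = dist x y := hq0
  obtain ⟨z1, b1, d1, e1⟩ := c.exists_between_dist hX x q0 (2 * m)
  obtain ⟨z2, b2, d2, e2⟩ := c.exists_between_dist hX y q0 (2 * m)
  have b1' : dist x z1 + dist z1 q0 = dist x q0 := b1
  have b2' : dist y z2 + dist z2 q0 = dist y q0 := b2
  rw [dist_comm y z2, dist_comm z2 q0, dist_comm y q0] at b2'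
  have hz1 : MetricBetween x z1 y := by
    have t1 := dist_triangle z1 q0 y
    have t2 := dist_triangle x z1 y
    unfold MetricBetween; linarith
  have hz2 : MetricBetween x z2 y := by
    have t1 := dist_triangle x q0 z2
    have t2 := dist_triangle x z2 y
    unfold MetricBetween; linarith
  have hz : MetricBetween z1 q0 z2 := by
    have t1 := dist_triangle z1 q0 z2
    have t2 := dist_triangle x z1 y
    have t3 := dist_triangle z1 z2 y
    unfold MetricBetween; linarith
  -- the legs joining the two points to the geodesic stay far from `q0`
  have leg : ∀ z, MetricBetween x z y →
      (2 * m ≤ K.dist (c.proj z) (c.proj q0) ∨ c.proj z ∈ α.support) →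
      ∃ a ∈ α.support, ∃ w : K.Walk (c.proj z) a, w.length ≤ m ∧
        ∀ u ∈ w.support, m ≤ K.dist (c.proj q0) u := by
    intro z hz h
    rcases h with h | h
    · obtain ⟨a, ha, hd⟩ := hnear z hz
      obtain ⟨w, hw⟩ := c.connected.exists_walk_length_eq_dist (c.proj z) a
      refine ⟨a, ha, w, by omega, fun u hu => ?_⟩
      have h1 := w.dist_le_length_of_mem_support hu
      have h2 := c.connected.dist_triangle (u := c.proj z) (v := u) (w := c.proj q0)
      rw [SimpleGraph.dist_comm (u := u)] at h2
      omega
    · exact ⟨_, h, SimpleGraph.Walk.nil, by simp, fun u hu => by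
        rw [SimpleGraph.Walk.support_nil, List.mem_singleton] at hu
        rw [hu]; exact hfar _ h⟩
  obtain ⟨a1, ha1, w1, l1, f1⟩ := leg z1 hz1 (e1.imp_right fun h => by rw [h]; exact α.start_mem_support)
  obtain ⟨a2, ha2, w2, l2, f2⟩ := leg z2 hz2 (e2.imp_right fun h => by rw [h]; exact α.end_mem_support)
  obtain ⟨w, hw, hws⟩ := α.exists_subwalk hα c.connected ha1 ha2
  have hlen : K.dist a1 a2 ≤ 6 * m + 2 * c.D := by
    have t1 := c.connected.dist_triangle (u := a1) (v := c.proj z1) (w := a2)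
    have t2 := c.connected.dist_triangle (u := c.proj z1) (v := c.proj q0) (w := a2)
    have t3 := c.connected.dist_triangle (u := c.proj q0) (v := c.proj z2) (w := a2)
    have s1 := SimpleGraph.dist_le w1
    have s2 := SimpleGraph.dist_le w2
    rw [SimpleGraph.dist_comm] at s1
    rw [SimpleGraph.dist_comm (u := c.proj z2)] at d2
    omega
  obtain ⟨u, hu, hud⟩ := c.exists_dist_le_of_walk hX k ((w1.append w).append w2.reverse) (by
      rw [SimpleGraph.Walk.length_append, SimpleGraph.Walk.length_append,
        SimpleGraph.Walk.length_reverse]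
      omega) (c.rep_proj z1) (c.rep_proj z2) hz
  have : m ≤ K.dist (c.proj q0) u := by
    rw [SimpleGraph.Walk.mem_support_append_iff, SimpleGraph.Walk.mem_support_append_iff,
      SimpleGraph.Walk.support_reverse, List.mem_reverse] at hu
    rcases hu with (h | h) | h
    · exact f1 u h
    · exact hfar u (hws h)
    · exact f2 u h
  omega

/-- A graph that coarsely models a CAT(-1) space as in `CoarseGraphModel` is hyperbolic. -/
theorem isHyperbolic [CompleteSpace X] (c : CoarseGraphModel X K) (hX : IsCATNegOne X) :
    K.IsHyperbolic := by
  obtain ⟨M, hM⟩ := c.exists_dist_le_of_geodesic hX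
  have hbet : ∀ {x y q : X}, MetricBetween x q y → K.dist (c.proj x) (c.proj q) +
      K.dist (c.proj q) (c.proj y) ≤ K.dist (c.proj x) (c.proj y) + 2 * M := by
    intro x y q hq
    obtain ⟨α, hα⟩ := c.connected.exists_walk_length_eq_dist (c.proj x) (c.proj y)
    obtain ⟨a, ha, hd⟩ := hM α hα hq
    have h1 := α.dist_add_dist_le_length ha
    have t1 := c.connected.dist_triangle (u := c.proj x) (v := a) (w := c.proj q)
    have t2 := c.connected.dist_triangle (u := c.proj q) (v := a) (w := c.proj y)
    rw [SimpleGraph.dist_comm (u := a) (v := c.proj q)] at t1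
    omega
  have hnear : ∀ {x y q p : X}, MetricBetween x q y → dist p q ≤ 3 → K.dist (c.proj x) (c.proj p) +
      K.dist (c.proj p) (c.proj y) ≤ K.dist (c.proj x) (c.proj y) + 2 * M + 2 * c.D := by
    intro x y q p hq hpq
    have h1 := hbet hq
    have h2 := c.dist_proj_le p q hpq
    have t1 := c.connected.dist_triangle (u := c.proj x) (v := c.proj q) (w := c.proj p)
    have t2 := c.connected.dist_triangle (u := c.proj p) (v := c.proj q) (w := c.proj y)
    rw [SimpleGraph.dist_comm (u := c.proj q) (v := c.proj p)] at t1
    omega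
  have four : ∀ x y z w : X, K.dist (c.proj x) (c.proj y) + K.dist (c.proj z) (c.proj w) ≤
      max (K.dist (c.proj x) (c.proj z) + K.dist (c.proj y) (c.proj w))
        (K.dist (c.proj x) (c.proj w) + K.dist (c.proj y) (c.proj z)) + (4 * M + 4 * c.D) := by
    intro x y z w
    obtain ⟨u, hu, hu1, hu2⟩ := hX.exists_center x y w
    obtain ⟨q1, hq1, hd1⟩ := hu1 u (metricBetween_right x u)
    obtain ⟨q2, hq2, hd2⟩ := hu2 u (metricBetween_left u y)
    obtain ⟨q3, hq3, hd3⟩ := hX.exists_near_of_metricBetween z hu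
    have n1 := hnear hq1 hd1
    have n2 := hnear hq2 hd2
    have t1 := c.connected.dist_triangle (u := c.proj x) (v := c.proj u) (w := c.proj y)
    have t2 := c.connected.dist_triangle (u := c.proj z) (v := c.proj u) (w := c.proj w)
    have s1 := SimpleGraph.dist_comm (G := K) (u := c.proj w) (v := c.proj u)
    have s2 := SimpleGraph.dist_comm (G := K) (u := c.proj y) (v := c.proj w)
    have s3 := SimpleGraph.dist_comm (G := K) (u := c.proj z) (v := c.proj u)
    have s4 := SimpleGraph.dist_comm (G := K) (u := c.proj z) (v := c.proj y)
    rcases hq3 with h | h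
    · have n3 := hnear h hd3
      omega
    · have n3 := hnear h hd3
      omega
  refine ⟨(4 * M + 4 * c.D + 8 * c.D : ℕ), fun a b e f => ?_⟩
  obtain ⟨x, hx⟩ := c.exists_rep a
  obtain ⟨y, hy⟩ := c.exists_rep b
  obtain ⟨z, hz⟩ := c.exists_rep e
  obtain ⟨w, hw⟩ := c.exists_rep f
  have hclose : ∀ {x v}, c.rep x v → K.dist (c.proj x) v ≤ c.D := fun {x v} h =>
    c.dist_between_le v v x x x h h (Or.inl rfl) (metricBetween_left x x)
  have hcmp : ∀ {x y v w}, c.rep x v → c.rep y w → K.dist v w ≤ K.dist (c.proj x) (c.proj y) + 2 * c.D ∧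
      K.dist (c.proj x) (c.proj y) ≤ K.dist v w + 2 * c.D := by
    intro x y v w h1 h2
    have k1 := hclose h1
    have k2 := hclose h2
    have t1 := c.connected.dist_triangle (u := v) (v := c.proj x) (w := w)
    have t2 := c.connected.dist_triangle (u := c.proj x) (v := c.proj y) (w := w)
    have t3 := c.connected.dist_triangle (u := c.proj x) (v := v) (w := c.proj y)
    have t4 := c.connected.dist_triangle (u := v) (v := w) (w := c.proj y)
    have s1 := SimpleGraph.dist_comm (G := K) (u := c.proj x) (v := v)
    have s2 := SimpleGraph.dist_comm (G := K) (u := c.proj y) (v := w)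
    omega
  have h := four x y z w
  have k1 := hcmp hx hy
  have k2 := hcmp hz hw
  have k3 := hcmp hx hz
  have k4 := hcmp hy hw
  have k5 := hcmp hx hw
  have k6 := hcmp hy hz
  have fin : K.dist a b + K.dist e f ≤ max (K.dist a e + K.dist b f) (K.dist a f + K.dist b e) +
      2 * (4 * M + 4 * c.D + 8 * c.D) := by omega
  exact_mod_cast fin

end CoarseGraphModel

/-! ### A criterion for fineness -/

namespace SimpleGraph

variable {V : Type*} {K : SimpleGraph V}

/-- A graph is fine as soon as, for each edge `ab` and each `n`, there are only finitely many
neighbours `x` of `b` such that `a` and `x` are joined by a path of length at most `n` that avoids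
`b`. Indeed a circuit through a given edge can be read off edge by edge, with finitely many
choices at each step. -/
theorem isFine_of_finite_link
    (h : ∀ (n : ℕ) (a b : V), K.Adj a b → {x : V | K.Adj b x ∧ ∃ k ≤ n, ∃ g : ℕ → V, g 0 = a ∧
      g k = x ∧ (∀ i < k, K.Adj (g i) (g (i + 1))) ∧ ∀ i ≤ k, g i ≠ b}.Finite) :
    K.IsFine := by
  intro n e he
  induction e with
  | _ a b =>
  rw [mem_edgeSet] at he
  let L : V → V → Set V := fun a b => {x : V | K.Adj b x ∧ ∃ k ≤ n, ∃ g : ℕ → V, g 0 = a ∧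
      g k = x ∧ (∀ i < k, K.Adj (g i) (g (i + 1))) ∧ ∀ i ≤ k, g i ≠ b}
  have hL : ∀ a b, K.Adj a b → (L a b).Finite := fun a b hab => h n a b hab
  -- the directed edges that can be reached from `ab` in `k` steps
  let T : ℕ → Set (V × V) := fun k => Nat.rec {(a, b), (b, a)}
    (fun _ S => ⋃ p ∈ {p ∈ S | K.Adj p.1 p.2}, (fun x => (p.2, x)) '' L p.1 p.2) k
  have hT0 : T 0 = {(a, b), (b, a)} := rfl
  have hT1 : ∀ k, T (k + 1) = ⋃ p ∈ {p ∈ T k | K.Adj p.1 p.2}, (fun x => (p.2, x)) '' L p.1 p.2 :=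
    fun k => rfl
  have hT : ∀ k, (T k).Finite := by
    intro k
    induction k with
    | zero => rw [hT0]; exact Set.toFinite _
    | succ k ih =>
      rw [hT1]
      exact (ih.subset (Set.sep_subset _ _)).biUnion fun p hp => (hL _ _ hp.2).image _
  let W : Set V := ⋃ k ∈ Set.Iio n, Prod.fst '' T k
  have hW : W.Finite := (Set.finite_Iio n).biUnion fun k _ => (hT k).image _
  have hlists : {l : List V | l.length ≤ n ∧ ∀ x ∈ l, x ∈ W}.Finite := by
    have := hW.to_subtype
    refine ((List.finite_length_le W n).image (List.map Subtype.val)).subset ?_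
    rintro l ⟨hl, hlW⟩
    exact ⟨l.attach.map fun x => ⟨x.1, hlW x.1 x.2⟩, by simpa using hl, by simp⟩
  refine Set.Finite.of_finite_image (f := fun c : Σ v : V, K.Walk v v => c.2.support)
    (hlists.subset ?_) ?_
  · rintro _ ⟨⟨v, c⟩, ⟨hc, hlen, hce⟩, rfl⟩
    dsimp only at hc hlen hce ⊢
    refine ⟨by rw [Walk.length_support]; omega, ?_⟩
    obtain ⟨m, hm⟩ : ∃ m, m = c.length := ⟨_, rfl⟩
    have hm3 : 3 ≤ m := hm ▸ hc.three_le_length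
    rw [← hm] at hlen
    -- periodic parametrization of the circuit
    obtain ⟨f, hf⟩ : ∃ f : ℕ → V, f = fun i => c.getVert (i % m) := ⟨_, rfl⟩
    have hclosed : c.getVert m = c.getVert 0 := by rw [hm, Walk.getVert_length, Walk.getVert_zero]
    have hfper : ∀ i, f (i + m) = f i := fun i => by simp [hf]
    have hfsucc : ∀ i, f (i + 1) = c.getVert (i % m + 1) := by
      intro i
      have hi : i % m < m := Nat.mod_lt _ (by omega)
      rw [hf]
      dsimp only
      rcases Nat.lt_or_ge (i % m + 1) m with h | h
      · rw [← Nat.mod_add_mod, Nat.mod_eq_of_lt h]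
      · have e : i % m + 1 = m := by omega
        rw [← Nat.mod_add_mod, e, Nat.mod_self, hclosed]
    have hfadj : ∀ i, K.Adj (f i) (f (i + 1)) := by
      intro i
      have hi : i % m < m := Nat.mod_lt _ (by omega)
      have h1 := c.adj_getVert_succ (i := i % m) (by omega)
      rw [hfsucc]
      simpa [hf] using h1
    have hfinj : ∀ i j, f i = f j → i % m = j % m := by
      intro i j hij
      have hi : i % m < m := Nat.mod_lt _ (by omega)
      have hj : j % m < m := Nat.mod_lt _ (by omega)
      simp only [hf] at hij
      exact hc.getVert_injOn' (by simp only [Set.mem_ofPred_eq]; omega)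
        (by simp only [Set.mem_ofPred_eq]; omega) hij
    have hstep : ∀ i, f (i + 2) ∈ L (f i) (f (i + 1)) := by
      intro i
      refine ⟨hfadj (i + 1), m - 2, by omega, fun j => f (i + m - j), ?_, ?_, ?_, ?_⟩
      · simp [hfper]
      · dsimp only; congr 1; omega
      · intro j hj
        dsimp only
        have := (hfadj (i + m - (j + 1))).symm
        rwa [show i + m - (j + 1) + 1 = i + m - j by omega] at this
      · intro j hj heq
        have h1 := hfinj _ _ heq
        have h2 : (i + m - j) = (i + 1) + (m - 1 - j) := by omega
        rw [h2] at h1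
        have h3 : (i + 1 + (m - 1 - j)) ≡ (i + 1) + 0 [MOD m] := h1
        have h4 := Nat.ModEq.add_left_cancel' _ h3
        have h5 : (m - 1 - j) % m = 0 := h4
        rw [Nat.mod_eq_of_lt (by omega)] at h5
        omega
    obtain ⟨i, hi⟩ : ∃ i, s(a, b) = s(f i, f (i + 1)) := by
      rw [Walk.mk_mem_edges_iff_exists] at hce
      obtain ⟨i, hi, h⟩ := hce
      rw [← hm] at hi
      refine ⟨i, ?_⟩
      rw [hfsucc, ← h, Nat.mod_eq_of_lt hi]
      simp [hf, Nat.mod_eq_of_lt hi]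
    have hmem : ∀ j, (f (i + j), f (i + j + 1)) ∈ T j := by
      intro j
      induction j with
      | zero =>
        rw [hT0]
        rw [Sym2.eq_iff] at hi
        rcases hi with ⟨h1, h2⟩ | ⟨h1, h2⟩
        · left; simp [h1, h2]
        · right; simp [h1, h2]
      | succ j ih =>
        rw [hT1]
        refine Set.mem_biUnion (x := (f (i + j), f (i + j + 1))) ⟨ih, hfadj _⟩ ⟨_, hstep (i + j), rfl⟩
    intro x hx
    obtain ⟨j, hj, hjm⟩ := Walk.mem_support_iff_exists_getVert.mp hx
    have hx' : x = f j := by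
      rw [hf]; dsimp only
      rcases Nat.lt_or_ge j m with h | h
      · rw [Nat.mod_eq_of_lt h, hj]
      · have : j = m := by omega
        rw [this, Nat.mod_self, ← hclosed, ← this, hj]
    -- the index modulo `m` can be chosen in `[i, i + m)`
    obtain ⟨t, ht, hft⟩ : ∃ t < m, f (i + t) = x := by
      refine ⟨(j + (m - i % m)) % m, Nat.mod_lt _ (by omega), ?_⟩
      rw [hx', hf]
      dsimp only
      congr 1
      have hi' : i % m < m := Nat.mod_lt _ (by omega)
      rw [Nat.add_mod_mod]
      have : i + (j + (m - i % m)) = j + m * (i / m + 1) := by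
        have := Nat.mod_add_div i m
        rw [mul_add, mul_one]
        omega
      rw [this, Nat.add_mul_mod_self_left]
    exact Set.mem_biUnion (show t ∈ Set.Iio n from by simp only [Set.mem_Iio]; omega)
      ⟨_, hmem t, hft⟩
  · rintro ⟨v, c⟩ - ⟨w, d⟩ - hcd
    dsimp only at hcd
    have hvw : v = w := by
      have h1 := c.head_support
      have h2 := d.head_support
      simp only [hcd] at h1
      exact h1.symm.trans h2
    subst hvw
    rw [Walk.ext_support hcd]

end SimpleGraph

/-! ### Nets in the complement of the interiors -/

section Net

variable {X : Type*} [MetricSpace X]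

/-- The complement of the interiors of the members of a family of sets. -/
def outerRegion (𝒜 : Set (Set X)) : Set X := (⋃ A ∈ 𝒜, interior A)ᶜ

theorem mem_outerRegion {𝒜 : Set (Set X)} {x : X} :
    x ∈ outerRegion 𝒜 ↔ ∀ A ∈ 𝒜, x ∉ interior A := by
  simp [outerRegion]

theorem isClosed_outerRegion (𝒜 : Set (Set X)) : IsClosed (outerRegion 𝒜) :=
  (isOpen_biUnion fun _ _ => isOpen_interior).isClosed_compl

theorem map_mem_outerRegion {H : Subgroup (X ≃ᵢ X)} {𝒜 : Set (Set X)}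
    (hinv : ∀ h ∈ H, ∀ A ∈ 𝒜, h '' A ∈ 𝒜) {h : X ≃ᵢ X} (hh : h ∈ H) {x : X}
    (hx : x ∈ outerRegion 𝒜) : h x ∈ outerRegion 𝒜 := by
  rw [mem_outerRegion] at hx ⊢
  intro A hA hxA
  refine hx _ (hinv h⁻¹ (H.inv_mem hh) A hA) ?_
  have : x = h⁻¹ (h x) := (h.symm_apply_apply x).symm
  rw [this]
  change h.symm.toHomeomorph (h x) ∈ interior (h.symm.toHomeomorph '' A)
  rw [← Homeomorph.image_interior]
  exact ⟨_, hxA, rfl⟩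

/-- An equivariant net in the complement of the interiors of a separated family, which is fine
enough with respect to the separation constant and to the local compactness of the complement. -/
structure ConingNet (H : Subgroup (X ≃ᵢ X)) (𝒜 : Set (Set X)) where
  /-- the net -/
  N : Set X
  /-- representatives of the orbits of the net -/
  F : Set X
  /-- the scale of the net -/
  R : ℝ
  R_pos : 0 < R
  separated : IsSeparatedFamily (3 * R) 𝒜
  subset : N ⊆ outerRegion 𝒜
  finite_F : F.Finite
  mem_iff : ∀ x, x ∈ N ↔ ∃ h ∈ H, ∃ f ∈ F, h f = x
  dense : ∀ z ∈ outerRegion 𝒜, ∃ n ∈ N, dist z n ≤ R / 4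
  fatten : ∀ C ⊆ outerRegion 𝒜, IsCompact C → ∃ C' ⊆ outerRegion 𝒜, IsCompact C' ∧
    ∀ z ∈ outerRegion 𝒜, ∀ c ∈ C, dist z c ≤ R → z ∈ C'
  locallyFinite : ∀ C ⊆ outerRegion 𝒜, IsCompact C → (N ∩ C).Finite

/-- A uniform form of local compactness that results from cocompactness. -/
theorem exists_fatten {H : Subgroup (X ≃ᵢ X)} {𝒜 : Set (Set X)}
    (hinv : ∀ h ∈ H, ∀ A ∈ 𝒜, h '' A ∈ 𝒜) (hlc : LocallyCompactSpace ↥(outerRegion 𝒜))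
    (hcc : ActsCocompactlyOn H (outerRegion 𝒜)) :
    ∃ δ > 0, ∀ C ⊆ outerRegion 𝒜, IsCompact C → ∃ C' ⊆ outerRegion 𝒜, IsCompact C' ∧
      ∀ z ∈ outerRegion 𝒜, ∀ c ∈ C, dist z c ≤ δ → z ∈ C' := by
  obtain ⟨K, hKZ, hK, hcov⟩ := hcc
  have hKs : IsCompact ((↑) ⁻¹' K : Set ↥(outerRegion 𝒜)) :=
    (isClosed_outerRegion 𝒜).isClosedEmbedding_subtypeVal.isCompact_preimage hK
  obtain ⟨L, hL, hKL⟩ := exists_compact_superset hKs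
  obtain ⟨δ, hδ, hδL⟩ := hKs.exists_cthickening_subset_open isOpen_interior hKL
  have hloc : ∀ z ∈ outerRegion 𝒜, ∀ c ∈ K, dist z c ≤ δ → z ∈ (Subtype.val '' L : Set X) :=
    fun z hz c hc hd =>
    ⟨⟨z, hz⟩, interior_subset (hδL (Metric.mem_cthickening_of_dist_le
      (⟨z, hz⟩ : ↥(outerRegion 𝒜)) ⟨c, hKZ hc⟩ δ _ hc hd)), rfl⟩
  refine ⟨δ / 2, by positivity, fun C hCZ hC => ?_⟩
  obtain ⟨t, htC, ht, hCt⟩ := hC.finite_cover_balls (half_pos hδ)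
  have hch : ∀ c : X, ∃ h : X ≃ᵢ X, h ∈ H ∧ (c ∈ t → c ∈ h '' K) := fun c => by
    by_cases hc : c ∈ t
    · obtain ⟨h, hh, hc'⟩ := hcov c (hCZ (htC hc))
      exact ⟨h, hh, fun _ => hc'⟩
    · exact ⟨1, H.one_mem, fun h => absurd h hc⟩
  choose h hh hhc using hch
  refine ⟨⋃ c ∈ t, h c '' (Subtype.val '' L), ?_, ?_, ?_⟩
  · refine Set.iUnion₂_subset fun c hc => ?_
    rintro _ ⟨_, ⟨z, -, rfl⟩, rfl⟩
    exact map_mem_outerRegion hinv (hh c) z.2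
  · exact ht.isCompact_biUnion fun c _ => (hL.image continuous_subtype_val).image (h c).continuous
  · intro z hz c hc hd
    obtain ⟨b, hbt, hcb⟩ := Set.mem_iUnion₂.mp (hCt hc)
    obtain ⟨k, hk, hkb⟩ := hhc b hbt
    refine Set.mem_biUnion hbt ⟨(h b)⁻¹ z, ?_, (h b).apply_symm_apply z⟩
    refine hloc _ (map_mem_outerRegion hinv (H.inv_mem (hh b)) hz) k hk ?_
    have e : dist ((h b)⁻¹ z) k = dist z b := by
      rw [← (h b).dist_eq, hkb]
      congr 1
      exact (h b).apply_symm_apply z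
    rw [e]
    have := Metric.mem_ball.mp hcb
    linarith [dist_triangle z c b]

theorem exists_coningNet {H : Subgroup (X ≃ᵢ X)} {𝒜 : Set (Set X)} {ε : ℝ} (hε : 0 < ε)
    (hinv : ∀ h ∈ H, ∀ A ∈ 𝒜, h '' A ∈ 𝒜) (hsep : IsSeparatedFamily ε 𝒜)
    (hlc : LocallyCompactSpace ↥(outerRegion 𝒜))
    (hpd : ActsProperlyDiscontinuouslyOn H (outerRegion 𝒜))
    (hcc : ActsCocompactlyOn H (outerRegion 𝒜)) : Nonempty (ConingNet H 𝒜) := by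
  obtain ⟨δ, hδ, hfat⟩ := exists_fatten hinv hlc hcc
  obtain ⟨K, hKZ, hK, hcov⟩ := hcc
  obtain ⟨R, hR⟩ : ∃ R, R = min δ (ε / 3) := ⟨_, rfl⟩
  have hR0 : 0 < R := by rw [hR]; positivity
  have hRδ : R ≤ δ := hR ▸ min_le_left _ _
  have hRε : R ≤ ε / 3 := hR ▸ min_le_right _ _
  obtain ⟨F, hFK, hF, hKF⟩ := hK.finite_cover_balls (show 0 < R / 4 by positivity)
  have hFZ : F ⊆ outerRegion 𝒜 := hFK.trans hKZ
  refine ⟨⟨{x | ∃ h ∈ H, ∃ f ∈ F, h f = x}, F, R, hR0, ?_, ?_, hF, fun _ => Iff.rfl, ?_, ?_, ?_⟩⟩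
  · intro A hA B hB hne a ha b hb
    exact (by linarith : 3 * R ≤ ε).trans (hsep A hA B hB hne a ha b hb)
  · rintro _ ⟨h, hh, f, hf, rfl⟩
    exact map_mem_outerRegion hinv hh (hFZ hf)
  · intro z hz
    obtain ⟨h, hh, k, hk, rfl⟩ := hcov z hz
    obtain ⟨f, hf, hkf⟩ := Set.mem_iUnion₂.mp (hKF hk)
    refine ⟨h f, ⟨h, hh, f, hf, rfl⟩, ?_⟩
    rw [h.dist_eq]
    exact (Metric.mem_ball.mp hkf).le
  · intro C hCZ hC
    obtain ⟨C', h1, h2, h3⟩ := hfat C hCZ hC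
    exact ⟨C', h1, h2, fun z hz c hc hd => h3 z hz c hc (hd.trans hRδ)⟩
  · intro C hCZ hC
    have hfin := hpd (F ∪ C) (Set.union_subset hFZ hCZ) (hF.isCompact.union hC)
    refine ((hfin.prod hF).image fun p : H × X => p.1.1 p.2).subset ?_
    rintro _ ⟨⟨h, hh, f, hf, rfl⟩, hfC⟩
    exact ⟨(⟨h, hh⟩, f), ⟨⟨h f, ⟨f, Or.inl hf, rfl⟩, Or.inr hfC⟩, hf⟩, rfl⟩

end Net

/-! ### The coned-off graph -/

namespace ConingNet

variable {X : Type u} [MetricSpace X] {H : Subgroup (X ≃ᵢ X)} {𝒜 : Set (Set X)}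
  (net : ConingNet H 𝒜)

theorem map_mem {h : X ≃ᵢ X} (hh : h ∈ H) {n : X} (hn : n ∈ net.N) : h n ∈ net.N := by
  obtain ⟨k, hk, f, hf, rfl⟩ := (net.mem_iff n).mp hn
  exact (net.mem_iff _).mpr ⟨h * k, H.mul_mem hh hk, f, hf, rfl⟩

theorem F_subset : net.F ⊆ net.N := fun f hf => (net.mem_iff f).mpr ⟨1, H.one_mem, f, hf, rfl⟩

/-- The vertices of the coned-off graph: the members of the family and the points of the net, the
latter encoded as singletons. -/
def Vertex : Type u := {s : Set X // s ∈ 𝒜 ∨ ∃ n ∈ net.N, s = {n}}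

/-- The coned-off graph: two vertices are adjacent if, as subsets of `X`, they come `R`-close. The
members of the family become cone points over their boundaries, and no two of them are adjacent. -/
def graph : SimpleGraph net.Vertex where
  Adj v w := v ≠ w ∧ ∃ x ∈ v.1, ∃ y ∈ w.1, dist x y ≤ net.R
  symm := ⟨fun v w ⟨h, x, hx, y, hy, hd⟩ => ⟨h.symm, y, hy, x, hx, by rwa [dist_comm]⟩⟩
  loopless := ⟨fun v h => h.1 rfl⟩

variable {net}

/-- The translate of a vertex. -/
def vertexMap (hinv : ∀ h ∈ H, ∀ A ∈ 𝒜, h '' A ∈ 𝒜) (h : H) (v : net.Vertex) : net.Vertex :=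
  ⟨h.1 '' v.1, by
    rcases v.2 with hv | ⟨n, hn, hv⟩
    · exact Or.inl (hinv h.1 h.2 _ hv)
    · exact Or.inr ⟨h.1 n, net.map_mem h.2 hn, by rw [hv, Set.image_singleton]⟩⟩

theorem vertexMap_mul (hinv : ∀ h ∈ H, ∀ A ∈ 𝒜, h '' A ∈ 𝒜) (g h : H) (v : net.Vertex) :
    vertexMap hinv (g * h) v = vertexMap hinv g (vertexMap hinv h v) := by
  apply Subtype.ext
  change (fun x => g.1 (h.1 x)) '' v.1 = g.1 '' (h.1 '' v.1)
  rw [Set.image_image]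

theorem vertexMap_one (hinv : ∀ h ∈ H, ∀ A ∈ 𝒜, h '' A ∈ 𝒜) (v : net.Vertex) :
    vertexMap hinv 1 v = v := by
  apply Subtype.ext
  change (fun x => x) '' v.1 = v.1
  simp

theorem adj_vertexMap (hinv : ∀ h ∈ H, ∀ A ∈ 𝒜, h '' A ∈ 𝒜) (h : H) {v w : net.Vertex}
    (hvw : net.graph.Adj v w) : net.graph.Adj (vertexMap hinv h v) (vertexMap hinv h w) := by
  obtain ⟨hne, x, hx, y, hy, hd⟩ := hvw
  refine ⟨fun heq => hne ?_, h.1 x, ⟨x, hx, rfl⟩, h.1 y, ⟨y, hy, rfl⟩, by rwa [h.1.dist_eq]⟩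
  have := congrArg (vertexMap hinv h⁻¹) heq
  rwa [← vertexMap_mul, ← vertexMap_mul, inv_mul_cancel, vertexMap_one, vertexMap_one] at this

/-- The automorphism of the coned-off graph defined by a group element. -/
def graphIso (hinv : ∀ h ∈ H, ∀ A ∈ 𝒜, h '' A ∈ 𝒜) (h : H) : net.graph ≃g net.graph where
  toFun := vertexMap hinv h
  invFun := vertexMap hinv h⁻¹
  left_inv v := by rw [← vertexMap_mul, inv_mul_cancel, vertexMap_one]
  right_inv v := by rw [← vertexMap_mul, mul_inv_cancel, vertexMap_one]
  map_rel_iff' := by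
    intro v w
    refine ⟨fun hvw => ?_, adj_vertexMap hinv h⟩
    have := adj_vertexMap hinv h⁻¹ hvw
    change net.graph.Adj (vertexMap hinv h⁻¹ (vertexMap hinv h v))
      (vertexMap hinv h⁻¹ (vertexMap hinv h w)) at this
    rwa [← vertexMap_mul, ← vertexMap_mul, inv_mul_cancel, vertexMap_one, vertexMap_one] at this

/-- The action of the group on the coned-off graph. -/
def action (net : ConingNet H 𝒜) (hinv : ∀ h ∈ H, ∀ A ∈ 𝒜, h '' A ∈ 𝒜) :
    H →* (net.graph ≃g net.graph) :=
  MonoidHom.mk' (graphIso hinv) fun g h => by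
    ext v
    exact vertexMap_mul hinv g h v

theorem action_apply (hinv : ∀ h ∈ H, ∀ A ∈ 𝒜, h '' A ∈ 𝒜) (h : H) (v : net.Vertex) :
    net.action hinv h v = vertexMap hinv h v := rfl

theorem mem_of_mem_vertex {v : net.Vertex} (hv : v.1 ∉ 𝒜) : ∃ n ∈ net.N, v.1 = {n} :=
  v.2.resolve_left hv

theorem vertex_nonempty (hA : ∀ A ∈ 𝒜, A.Nonempty ∧ IsClosed A ∧ IsGeodesicallyConvex A)
    (v : net.Vertex) : v.1.Nonempty := by
  rcases v.2 with hv | ⟨n, hn, hv⟩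
  · exact (hA _ hv).1
  · rw [hv]; exact Set.singleton_nonempty n

theorem vertex_convex (hA : ∀ A ∈ 𝒜, A.Nonempty ∧ IsClosed A ∧ IsGeodesicallyConvex A)
    (v : net.Vertex) : IsGeodesicallyConvex v.1 := by
  rcases v.2 with hv | ⟨n, hn, hv⟩
  · exact (hA _ hv).2.2
  · rw [hv]
    rintro x rfl y hy p hp
    rw [show y = x from hy] at hp
    have hp' : dist x p + dist p x = dist x x := hp
    rw [dist_self, dist_comm p x] at hp'
    exact (dist_eq_zero.mp (by linarith)).symm

theorem eq_of_close {A B : Set X} (hA : A ∈ 𝒜) (hB : B ∈ 𝒜) {a b : X} (ha : a ∈ A) (hb : b ∈ B)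
    (net : ConingNet H 𝒜) (hd : dist a b ≤ 2 * net.R) : A = B := by
  by_contra hne
  have := net.separated A hA B hB hne a ha b hb
  linarith [net.R_pos]

theorem not_mem_of_adj {v w : net.Vertex} (h : net.graph.Adj v w) (hv : v.1 ∈ 𝒜) : w.1 ∉ 𝒜 := by
  obtain ⟨hne, x, hx, y, hy, hd⟩ := h
  intro hw
  exact hne (Subtype.ext (eq_of_close hv hw hx hy net (by linarith [net.R_pos])))

/-- Only finitely many vertices come close to a given point of the complement. -/
theorem finite_near {z : X} (hz : z ∈ outerRegion 𝒜) :
    {v : net.Vertex | ∃ y ∈ v.1, dist z y ≤ net.R}.Finite := by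
  obtain ⟨C, hCZ, hC, hzC⟩ := net.fatten {z} (Set.singleton_subset_iff.mpr hz) isCompact_singleton
  have h1 : {v : net.Vertex | v.1 ∈ 𝒜 ∧ ∃ y ∈ v.1, dist z y ≤ net.R}.Finite := by
    apply Set.Subsingleton.finite
    rintro v ⟨hv, x, hx, hdx⟩ w ⟨hw, y, hy, hdy⟩
    refine Subtype.ext (eq_of_close hv hw hx hy net ?_)
    linarith [dist_triangle_left x y z]
  have h2 : {v : net.Vertex | ∃ n ∈ net.N ∩ C, v.1 = {n}}.Finite := by
    refine Set.Finite.of_finite_image (f := Subtype.val)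
      (((net.locallyFinite C hCZ hC).image fun n => ({n} : Set X)).subset ?_)
      Subtype.val_injective.injOn
    rintro _ ⟨v, ⟨n, hn, hv⟩, rfl⟩
    exact ⟨n, hn, hv.symm⟩
  refine (h1.union h2).subset ?_
  rintro v ⟨y, hy, hd⟩
  rcases v.2 with hv | ⟨n, hn, hv⟩
  · exact Or.inl ⟨hv, y, hy, hd⟩
  · refine Or.inr ⟨n, ⟨hn, hzC n (net.subset hn) z rfl ?_⟩, hv⟩
    rw [hv] at hy
    rw [← show y = n from hy, dist_comm]
    exact hd

/-! ### Orbits and stabilizers -/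

theorem finite_setOf_map_eq (hinv : ∀ h ∈ H, ∀ A ∈ 𝒜, h '' A ∈ 𝒜)
    (hpd : ActsProperlyDiscontinuouslyOn H (outerRegion 𝒜)) {n : X} (hn : n ∈ outerRegion 𝒜)
    (t : Set X) : {g : H | g.1 '' {n} = t}.Finite := by
  rcases Set.eq_empty_or_nonempty {g : H | g.1 '' {n} = t} with h | ⟨g0, h0⟩
  · rw [h]; exact Set.finite_empty
  · have hm : g0.1 n ∈ outerRegion 𝒜 := map_mem_outerRegion hinv g0.2 hn
    refine (hpd {n, g0.1 n} (Set.insert_subset hn (Set.singleton_subset_iff.mpr hm))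
      (Set.toFinite _).isCompact).subset ?_
    intro g hg
    rw [Set.mem_ofPred_eq] at hg h0
    rw [← h0, Set.image_singleton, Set.image_singleton, Set.singleton_eq_singleton_iff] at hg
    exact ⟨g.1 n, ⟨n, Or.inl rfl, rfl⟩, Or.inr hg⟩

theorem finite_edge_stabilizer (hinv : ∀ h ∈ H, ∀ A ∈ 𝒜, h '' A ∈ 𝒜)
    (hpd : ActsProperlyDiscontinuouslyOn H (outerRegion 𝒜)) (e : Sym2 net.Vertex)
    (he : e ∈ net.graph.edgeSet) : {g : H | Sym2.map (net.action hinv g) e = e}.Finite := by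
  have main : ∀ v w : net.Vertex, v.1 ∉ 𝒜 →
      {g : H | Sym2.map (net.action hinv g) s(v, w) = s(v, w)}.Finite := by
    intro v w hv
    obtain ⟨n, hn, hvn⟩ := mem_of_mem_vertex hv
    refine ((finite_setOf_map_eq hinv hpd (net.subset hn) v.1).union
      (finite_setOf_map_eq hinv hpd (net.subset hn) w.1)).subset ?_
    intro g hg
    rw [Set.mem_ofPred_eq, Sym2.map_mk, Sym2.eq_iff] at hg
    have h1 : (net.action hinv g v).1 = g.1 '' {n} := by rw [← hvn]; rfl
    rcases hg with h | h
    · left; rw [Set.mem_ofPred_eq, ← h1]; exact congrArg Subtype.val h.1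
    · right; rw [Set.mem_ofPred_eq, ← h1]; exact congrArg Subtype.val h.1
  induction e with
  | _ v w =>
  by_cases hv : v.1 ∈ 𝒜
  · rw [Sym2.eq_swap]
    exact main w v (not_mem_of_adj he hv)
  · exact main v w hv

theorem finite_edge_orbits (hinv : ∀ h ∈ H, ∀ A ∈ 𝒜, h '' A ∈ 𝒜) :
    ∃ S : Set (Sym2 net.Vertex), S.Finite ∧
      ∀ e ∈ net.graph.edgeSet, ∃ s ∈ S, ∃ g, Sym2.map (net.action hinv g) s = e := by
  refine ⟨⋃ f ∈ net.F, (fun p : net.Vertex × net.Vertex => s(p.1, p.2)) ''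
    ({v : net.Vertex | ∃ y ∈ v.1, dist f y ≤ net.R} ×ˢ
      {v : net.Vertex | ∃ y ∈ v.1, dist f y ≤ net.R}),
    net.finite_F.biUnion fun f hf => ((finite_near (net.subset (net.F_subset hf))).prod
      (finite_near (net.subset (net.F_subset hf)))).image _, fun e he => ?_⟩
  have main : ∀ v w : net.Vertex, net.graph.Adj v w → v.1 ∉ 𝒜 → ∃ f ∈ net.F, ∃ g : H,
      ∃ v' w' : net.Vertex, (∃ y ∈ v'.1, dist f y ≤ net.R) ∧ (∃ y ∈ w'.1, dist f y ≤ net.R) ∧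
        vertexMap hinv g v' = v ∧ vertexMap hinv g w' = w := by
    intro v w hvw hv
    obtain ⟨n, hn, hvn⟩ := mem_of_mem_vertex hv
    obtain ⟨h, hh, f, hf, rfl⟩ := (net.mem_iff n).mp hn
    obtain ⟨-, x, hx, y, hy, hd⟩ := hvw
    have hxn : x = h f := by rw [hvn] at hx; exact hx
    obtain ⟨g, hg⟩ : ∃ g : H, g = ⟨h, hh⟩ := ⟨_, rfl⟩
    have hginv : ∀ z, (g⁻¹).1 (h z) = z := fun z => by rw [hg]; exact h.symm_apply_apply z
    have hinvg : ∀ z, h ((g⁻¹).1 z) = z := fun z => by rw [hg]; exact h.apply_symm_apply z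
    refine ⟨f, hf, g, vertexMap hinv g⁻¹ v, vertexMap hinv g⁻¹ w, ⟨f, ?_, ?_⟩,
      ⟨(g⁻¹).1 y, ⟨y, hy, rfl⟩, ?_⟩, ?_, ?_⟩
    · exact ⟨h f, hxn ▸ hx, hginv f⟩
    · rw [dist_self]; exact net.R_pos.le
    · rw [← h.dist_eq, hinvg, ← hxn]; exact hd
    · rw [← vertexMap_mul, mul_inv_cancel, vertexMap_one]
    · rw [← vertexMap_mul, mul_inv_cancel, vertexMap_one]
  induction e with
  | _ v w =>
  by_cases hv : v.1 ∈ 𝒜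
  · obtain ⟨f, hf, g, w', v', hw', hv', e1, e2⟩ :=
      main w v (SimpleGraph.Adj.symm he) (not_mem_of_adj he hv)
    refine ⟨s(v', w'), Set.mem_biUnion hf ⟨(v', w'), ⟨hv', hw'⟩, rfl⟩, g, ?_⟩
    rw [Sym2.map_mk, action_apply, action_apply, e1, e2]
  · obtain ⟨f, hf, g, v', w', hv', hw', e1, e2⟩ := main v w he hv
    refine ⟨s(v', w'), Set.mem_biUnion hf ⟨(v', w'), ⟨hv', hw'⟩, rfl⟩, g, ?_⟩
    rw [Sym2.map_mk, action_apply, action_apply, e1, e2]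

theorem vertexStabilizer_action (hinv : ∀ h ∈ H, ∀ A ∈ 𝒜, h '' A ∈ 𝒜) (v : net.Vertex) :
    vertexStabilizer (net.action hinv) v = setStabilizer H v.1 := by
  ext g
  change vertexMap hinv g v = v ↔ g.1 '' v.1 = v.1
  exact ⟨fun h => congrArg Subtype.val h, fun h => Subtype.ext h⟩

theorem finite_vertexStabilizer (hinv : ∀ h ∈ H, ∀ A ∈ 𝒜, h '' A ∈ 𝒜)
    (hpd : ActsProperlyDiscontinuouslyOn H (outerRegion 𝒜)) {v : net.Vertex} (hv : v.1 ∉ 𝒜) :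
    (vertexStabilizer (net.action hinv) v : Set H).Finite := by
  obtain ⟨n, hn, hvn⟩ := mem_of_mem_vertex hv
  rw [vertexStabilizer_action, hvn]
  exact finite_setOf_map_eq hinv hpd (net.subset hn) {n}

/-! ### Projections to members of the family -/

/-- Nearest points of a member of the family to points outside of its interior lie in the
complement of the interiors. -/
theorem foot_mem_outerRegion [CompleteSpace X] (net : ConingNet H 𝒜)
    (hX : IsCATNegOne X)
    (hA : ∀ A ∈ 𝒜, A.Nonempty ∧ IsClosed A ∧ IsGeodesicallyConvex A) {A : Set X} (hA' : A ∈ 𝒜)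
    {x : X} (hx : x ∉ interior A) : foot A x ∈ outerRegion 𝒜 := by
  obtain ⟨hne, hc, hconv⟩ := hA A hA'
  have hf := hX.isFoot_foot hc hne hconv x
  rw [mem_outerRegion]
  intro B hB hfB
  have hBA : A = B := eq_of_close hA' hB hf.1 (interior_subset hfB) net (by
    rw [dist_self]; linarith [net.R_pos])
  subst hBA
  obtain ⟨r, hr, hball⟩ := Metric.isOpen_iff.mp isOpen_interior _ hfB
  rcases (dist_nonneg : 0 ≤ dist x (foot A x)).eq_or_lt with h0 | h0
  · rw [← dist_eq_zero.mp h0.symm] at hfB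
    exact hx hfB
  · -- a point slightly closer to `x` than the foot would still lie in the set
    obtain ⟨s, hs⟩ : ∃ s, s = min (r / 2) (dist x (foot A x)) := ⟨_, rfl⟩
    have hs0 : 0 < s := by rw [hs]; positivity
    obtain ⟨p, -, p1, p2⟩ := hX.exists_dist_eq (foot A x) x hs0.le
      (by rw [dist_comm, hs]; exact min_le_right _ _)
    have hp : p ∈ A := interior_subset (hball (by
      rw [Metric.mem_ball, dist_comm, p1, hs]
      exact (min_le_left _ _).trans_lt (by linarith)))
    have := hf.2 p hp
    rw [dist_comm x p, p2, dist_comm (foot A x)] at this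
    linarith

theorem finite_vertex_orbits [CompleteSpace X] (hX : IsCATNegOne X)
    (hinv : ∀ h ∈ H, ∀ A ∈ 𝒜, h '' A ∈ 𝒜)
    (hA : ∀ A ∈ 𝒜, A.Nonempty ∧ IsClosed A ∧ IsGeodesicallyConvex A) :
    ∃ S : Set net.Vertex, S.Finite ∧ ∀ v, ∃ s ∈ S, ∃ g, net.action hinv g s = v := by
  refine ⟨(⋃ f ∈ net.F, {v : net.Vertex | ∃ y ∈ v.1, dist f y ≤ net.R}) ∪ {v | v.1 = Set.univ},
    (net.finite_F.biUnion fun f hf => finite_near (net.subset (net.F_subset hf))).union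
      (Set.Subsingleton.finite fun v hv w hw => Subtype.ext (hv.trans hw.symm)), fun v => ?_⟩
  by_cases huniv : v.1 = Set.univ
  · exact ⟨v, Or.inr huniv, 1, vertexMap_one hinv v⟩
  · obtain ⟨y, hy, n, hn, hd⟩ : ∃ y ∈ v.1, ∃ n ∈ net.N, dist y n ≤ net.R := by
      rcases v.2 with hv | ⟨n, hn, hv⟩
      · obtain ⟨hne, hc, hconv⟩ := hA _ hv
        obtain ⟨x, hx⟩ := (Set.ne_univ_iff_exists_notMem _).mp huniv
        have h1 := net.foot_mem_outerRegion hX hA hv (fun h => hx (interior_subset h))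
        obtain ⟨n, hn, hd⟩ := net.dense _ h1
        exact ⟨_, (hX.isFoot_foot hc hne hconv x).1, n, hn, by linarith [net.R_pos]⟩
      · exact ⟨n, hv ▸ rfl, n, hn, by rw [dist_self]; exact net.R_pos.le⟩
    obtain ⟨h, hh, f, hf, rfl⟩ := (net.mem_iff n).mp hn
    obtain ⟨g, hg⟩ : ∃ g : H, g = ⟨h, hh⟩ := ⟨_, rfl⟩
    have hinvg : ∀ z, h ((g⁻¹).1 z) = z := fun z => by rw [hg]; exact h.apply_symm_apply z
    refine ⟨vertexMap hinv g⁻¹ v, Or.inl (Set.mem_biUnion hf ⟨(g⁻¹).1 y, ⟨y, hy, rfl⟩, ?_⟩), g, ?_⟩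
    · rw [← h.dist_eq, hinvg, dist_comm]; exact hd
    · rw [action_apply, ← vertexMap_mul, mul_inv_cancel, vertexMap_one]

/-! ### Fineness -/

theorem exists_fatten_chain (net : ConingNet H 𝒜) (M : ℕ) : ∀ C ⊆ outerRegion 𝒜, IsCompact C →
    ∃ C' ⊆ outerRegion 𝒜, IsCompact C' ∧ ∀ z : ℕ → X, z 0 ∈ C → (∀ i, z i ∈ outerRegion 𝒜) →
      (∀ i < M, dist (z i) (z (i + 1)) ≤ net.R) → z M ∈ C' := by
  induction M with
  | zero => exact fun C hCZ hC => ⟨C, hCZ, hC, fun z h _ _ => h⟩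
  | succ M ih =>
    intro C hCZ hC
    obtain ⟨C1, h1, h2, h3⟩ := ih C hCZ hC
    obtain ⟨C2, k1, k2, k3⟩ := net.fatten C1 h1 h2
    refine ⟨C2, k1, k2, fun z z0 hz hd => ?_⟩
    refine k3 _ (hz _) _ (h3 z z0 hz fun i hi => hd i (by omega)) ?_
    rw [dist_comm]
    exact hd M (by omega)

/-- If the projection of a vertex of the coned-off graph to another member `A` of the family meets
a compact set, then it is contained in a compact set that depends on the first one only. -/
theorem exists_fatten_vertex [CompleteSpace X] (hX : IsCATNegOne X)
    (hA : ∀ A ∈ 𝒜, A.Nonempty ∧ IsClosed A ∧ IsGeodesicallyConvex A) {A : Set X} (hA' : A ∈ 𝒜)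
    {C : Set X} (hCZ : C ⊆ outerRegion 𝒜) (hC : IsCompact C) :
    ∃ C' ⊆ outerRegion 𝒜, IsCompact C' ∧ ∀ v : net.Vertex, v.1 ≠ A → ∀ x ∈ v.1, foot A x ∈ C →
      ∀ y ∈ v.1, foot A y ∈ C' := by
  obtain ⟨hne, hc, hconv⟩ := hA A hA'
  obtain ⟨M, hM⟩ := hX.exists_chain_bound (ε := 3 * net.R) (by linarith [net.R_pos]) net.R_pos
  obtain ⟨C', h1, h2, h3⟩ := net.exists_fatten_chain M C hCZ hC
  refine ⟨C', h1, h2, fun v hv x hx hxC y hy => ?_⟩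
  rcases v.2 with hvA | ⟨n, hn, hvn⟩
  · have hfar : ∀ p ∈ v.1, ∀ a ∈ A, 3 * net.R ≤ dist p a := net.separated _ hvA _ hA' hv
    obtain ⟨p, p0, p1, pb, ps⟩ := hM A x y hc hne hconv fun p hp a ha =>
      hfar p ((hA _ hvA).2.2 x hx y hy p hp) a ha
    have hpv : ∀ i, p i ∈ v.1 := fun i => (hA _ hvA).2.2 x hx y hy _ (pb i)
    have := h3 (fun i => foot A (p i)) (by rw [p0]; exact hxC) (fun i => ?_) ps
    · rwa [p1] at this
    · refine net.foot_mem_outerRegion hX hA hA' fun hi => ?_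
      have := hfar _ (hpv i) _ (interior_subset hi)
      rw [dist_self] at this
      linarith [net.R_pos]
  · have hxy : x = y := by
      rw [hvn] at hx hy
      exact (show x = n from hx).trans (show y = n from hy).symm
    rw [← hxy]
    exact h3 (fun _ => foot A x) hxC (fun _ => hCZ hxC) fun _ _ => by
      rw [dist_self]; exact net.R_pos.le

theorem finite_link_cone [CompleteSpace X] (hX : IsCATNegOne X)
    (hA : ∀ A ∈ 𝒜, A.Nonempty ∧ IsClosed A ∧ IsGeodesicallyConvex A) (n : ℕ) {a b : net.Vertex}
    (hab : net.graph.Adj a b) (hb : b.1 ∈ 𝒜) :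
    {x : net.Vertex | net.graph.Adj b x ∧ ∃ k ≤ n, ∃ g : ℕ → net.Vertex, g 0 = a ∧ g k = x ∧
      (∀ i < k, net.graph.Adj (g i) (g (i + 1))) ∧ ∀ i ≤ k, g i ≠ b}.Finite := by
  obtain ⟨hne, hc, hconv⟩ := hA b.1 hb
  have hf := fun x => hX.isFoot_foot hc hne hconv x
  have hout : ∀ v : net.Vertex, v ≠ b → ∀ x ∈ v.1, foot b.1 x ∈ outerRegion 𝒜 := by
    intro v hv x hx
    refine net.foot_mem_outerRegion hX hA hb fun hi => ?_
    rcases v.2 with hvA | ⟨m, hm, hvm⟩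
    · refine hv (Subtype.ext (eq_of_close hvA hb hx (interior_subset hi) net ?_))
      rw [dist_self]; linarith [net.R_pos]
    · rw [hvm] at hx
      rw [show x = m from hx] at hi
      exact mem_outerRegion.mp (net.subset hm) _ hb hi
  -- the projections of the vertices that can be reached from `a` in `k` steps
  have main : ∀ k : ℕ, ∃ C ⊆ outerRegion 𝒜, IsCompact C ∧ ∀ g : ℕ → net.Vertex, g 0 = a →
      (∀ i < k, net.graph.Adj (g i) (g (i + 1))) → (∀ i ≤ k, g i ≠ b) →
        ∀ y ∈ (g k).1, foot b.1 y ∈ C := by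
    intro k
    induction k with
    | zero =>
      obtain ⟨x0, hx0⟩ := vertex_nonempty hA a
      obtain ⟨C, h1, h2, h3⟩ := exists_fatten_vertex (net := net) hX hA hb (C := {foot b.1 x0})
        (Set.singleton_subset_iff.mpr (hout a hab.1 x0 hx0)) isCompact_singleton
      refine ⟨C, h1, h2, fun g g0 _ _ y hy => ?_⟩
      rw [g0] at hy
      exact h3 a (fun h => hab.1 (Subtype.ext h)) x0 hx0 rfl y hy
    | succ k ih =>
      obtain ⟨C, h1, h2, h3⟩ := ih
      obtain ⟨C1, i1, i2, i3⟩ := net.fatten C h1 h2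
      obtain ⟨C2, j1, j2, j3⟩ := exists_fatten_vertex (net := net) hX hA hb i1 i2
      refine ⟨C2, j1, j2, fun g g0 hg hgb y hy => ?_⟩
      obtain ⟨-, u, hu, w, hw, hd⟩ := hg k (by omega)
      have e1 := h3 g g0 (fun i hi => hg i (by omega)) (fun i hi => hgb i (by omega)) u hu
      have hk := hgb (k + 1) le_rfl
      have e2 : foot b.1 w ∈ C1 := i3 _ (hout _ hk w hw) _ e1 (by
        rw [dist_comm]
        exact (hX.dist_le_of_isFoot hconv (hf u) (hf w)).trans hd)
      exact j3 _ (fun h => hk (Subtype.ext h)) w hw e2 y hy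
  choose C hCZ hC hCg using main
  choose C' hCZ' hC' hCC' using fun k => net.fatten (C k) (hCZ k) (hC k)
  refine Set.Finite.of_finite_image (f := Subtype.val)
    (((Set.finite_Iic n).biUnion fun k _ => ((net.locallyFinite _ (hCZ' k) (hC' k)).image
      fun m => ({m} : Set X))).subset ?_) Subtype.val_injective.injOn
  rintro _ ⟨x, ⟨hbx, k, hk, g, g0, gk, hg, hgb⟩, rfl⟩
  obtain ⟨m, hm, hxm⟩ := mem_of_mem_vertex (not_mem_of_adj hbx hb)
  refine Set.mem_biUnion (show k ∈ Set.Iic n from hk) ⟨m, ⟨hm, ?_⟩, hxm.symm⟩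
  have hmx : m ∈ x.1 := by rw [hxm]; rfl
  refine hCC' k m (net.subset hm) (foot b.1 m) (hCg k g g0 hg hgb m (gk ▸ hmx)) ?_
  obtain ⟨-, u, hu, w, hw, hd⟩ := hbx
  rw [hxm] at hw
  rw [show w = m from hw, dist_comm] at hd
  exact ((hf m).2 u hu).trans hd

theorem graph_isFine [CompleteSpace X] (hX : IsCATNegOne X)
    (hA : ∀ A ∈ 𝒜, A.Nonempty ∧ IsClosed A ∧ IsGeodesicallyConvex A) : net.graph.IsFine := by
  refine SimpleGraph.isFine_of_finite_link fun n a b hab => ?_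
  by_cases hb : b.1 ∈ 𝒜
  · exact finite_link_cone hX hA n hab hb
  · obtain ⟨m, hm, hbm⟩ := mem_of_mem_vertex hb
    refine (finite_near (net := net) (net.subset hm)).subset ?_
    rintro x ⟨⟨-, u, hu, w, hw, hd⟩, -⟩
    rw [hbm] at hu
    rw [show u = m from hu] at hd
    exact ⟨w, hw, hd⟩

/-! ### Hyperbolicity -/

/-- A point is represented by the vertices that it is close to. -/
def Rep (x : X) (v : net.Vertex) : Prop := ∃ a ∈ v.1, dist x a ≤ net.R / 4

theorem exists_rep (net : ConingNet H 𝒜) (x : X) : ∃ v : net.Vertex, Rep x v := by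
  by_cases hx : x ∈ outerRegion 𝒜
  · obtain ⟨n, hn, hd⟩ := net.dense x hx
    exact ⟨⟨{n}, Or.inr ⟨n, hn, rfl⟩⟩, n, rfl, hd⟩
  · rw [mem_outerRegion] at hx
    push Not at hx
    obtain ⟨A, hA, hxA⟩ := hx
    exact ⟨⟨A, Or.inl hA⟩, x, interior_subset hxA, by
      rw [dist_self]; linarith [net.R_pos]⟩

theorem eq_or_adj_of_rep {x y : X} {v w : net.Vertex} (hx : Rep x v) (hy : Rep y w)
    (hd : dist x y ≤ net.R / 2) : v = w ∨ net.graph.Adj v w := by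
  obtain ⟨a, ha, hxa⟩ := hx
  obtain ⟨b, hb, hyb⟩ := hy
  refine or_iff_not_imp_left.mpr fun hne => ⟨hne, a, ha, b, hb, ?_⟩
  have t1 := dist_triangle a x b
  have t2 := dist_triangle x y b
  rw [dist_comm a x] at t1
  linarith

theorem exists_walk_of_rep (hX : IsCATNegOne X) (k : ℕ) : ∀ {x y : X} {v w : net.Vertex}, Rep x v →
    Rep y w → dist x y ≤ k * (net.R / 2) → ∃ p : net.graph.Walk v w, p.length ≤ k + 1 := by
  have hR := net.R_pos
  have base : ∀ {x y : X} {v w : net.Vertex}, Rep x v → Rep y w → dist x y ≤ net.R / 2 →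
      ∃ p : net.graph.Walk v w, p.length ≤ 1 := by
    intro x y v w hx hy hd
    rcases eq_or_adj_of_rep hx hy hd with h | h
    · subst h; exact ⟨SimpleGraph.Walk.nil, by simp⟩
    · exact ⟨h.toWalk, by simp⟩
  induction k with
  | zero =>
    intro x y v w hx hy hd
    rw [Nat.cast_zero, zero_mul] at hd
    exact base hx hy (hd.trans (by linarith))
  | succ k ih =>
    intro x y v w hx hy hd
    push_cast at hd
    obtain ⟨z, -, h1, h2⟩ := hX.exists_dist_eq x y (t := min (net.R / 2) (dist x y)) (by positivity)
      (min_le_right _ _)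
    obtain ⟨u, hu⟩ := net.exists_rep z
    obtain ⟨p, hp⟩ := base hx hu (h1 ▸ min_le_left _ _)
    obtain ⟨r, hr⟩ := ih hu hy (by
      rw [h2]
      rcases le_total (net.R / 2) (dist x y) with h3 | h3
      · rw [min_eq_left h3]; linarith
      · rw [min_eq_right h3, sub_self]; positivity)
    exact ⟨p.append r, by rw [SimpleGraph.Walk.length_append]; omega⟩

theorem exists_dist_le_of_rep (hX : IsCATNegOne X) (T : ℝ) :
    ∃ B : ℕ, ∀ {x y : X} {v w : net.Vertex}, Rep x v → Rep y w → dist x y ≤ T → net.graph.dist v w ≤ B := by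
  have hR := net.R_pos
  obtain ⟨k, hk⟩ := exists_nat_ge (T / (net.R / 2))
  rw [div_le_iff₀ (by positivity)] at hk
  refine ⟨k + 1, fun {x y v w} hx hy hd => ?_⟩
  obtain ⟨p, hp⟩ := exists_walk_of_rep hX k hx hy (hd.trans hk)
  exact (SimpleGraph.dist_le p).trans hp

theorem rep_of_mem {v : net.Vertex} {x : X} (hx : x ∈ v.1) : Rep x v :=
  ⟨x, hx, by rw [dist_self]; linarith [net.R_pos]⟩

theorem graph_connected [Nonempty X] (hX : IsCATNegOne X)
    (hA : ∀ A ∈ 𝒜, A.Nonempty ∧ IsClosed A ∧ IsGeodesicallyConvex A) : net.graph.Connected := by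
  have hR := net.R_pos
  rw [SimpleGraph.connected_iff]
  refine ⟨fun v w => ?_, ?_⟩
  · obtain ⟨x, hx⟩ := vertex_nonempty hA v
    obtain ⟨y, hy⟩ := vertex_nonempty hA w
    obtain ⟨k, hk⟩ := exists_nat_ge (dist x y / (net.R / 2))
    rw [div_le_iff₀ (by positivity)] at hk
    obtain ⟨p, -⟩ := exists_walk_of_rep hX k (rep_of_mem hx) (rep_of_mem hy) hk
    exact ⟨p⟩
  · obtain ⟨v, -⟩ := net.exists_rep (Classical.arbitrary X)
    exact ⟨v⟩

/-- A geodesic between points represented by equal or adjacent vertices stays close to these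
vertices: it is one side of a thin hexagon whose other sides are short or contained in the
vertices, which are convex. -/
theorem exists_near_vertex [CompleteSpace X] (hX : IsCATNegOne X)
    (hA : ∀ A ∈ 𝒜, A.Nonempty ∧ IsClosed A ∧ IsGeodesicallyConvex A) {v w : net.Vertex} {x y q : X}
    (hx : Rep x v) (hy : Rep y w) (hvw : v = w ∨ net.graph.Adj v w) (hq : MetricBetween x q y) :
    ∃ s, (s ∈ v.1 ∨ s ∈ w.1) ∧ dist q s ≤ 12 + net.R := by
  have hR := net.R_pos
  obtain ⟨a, ha, hxa⟩ := hx
  obtain ⟨b, hb, hyb⟩ := hy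
  obtain ⟨a', ha', b', hb', hab⟩ : ∃ a' ∈ v.1, ∃ b' ∈ w.1, dist a' b' ≤ net.R := by
    rcases hvw with h | h
    · exact ⟨a, ha, a, h ▸ ha, by rw [dist_self]; exact hR.le⟩
    · exact h.2
  have short : ∀ {u p z : X}, MetricBetween u p z → dist p z ≤ dist u z ∧ dist p u ≤ dist u z := by
    intro u p z hp
    have hp' : dist u p + dist p z = dist u z := hp
    rw [dist_comm p u]
    constructor <;> linarith [dist_nonneg (x := u) (y := p), dist_nonneg (x := p) (y := z)]
  obtain ⟨q1, h1, d1⟩ := hX.exists_near_of_metricBetween a hq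
  rcases h1 with h1 | h1
  · exact ⟨a, Or.inl ha, by linarith [dist_triangle q q1 a, (short h1).1]⟩
  obtain ⟨q2, h2, d2⟩ := hX.exists_near_of_metricBetween a' h1
  have t2 := dist_triangle q q1 q2
  rcases h2 with h2 | h2
  · exact ⟨q2, Or.inl (vertex_convex hA v a ha a' ha' _ h2), by linarith⟩
  obtain ⟨q3, h3, d3⟩ := hX.exists_near_of_metricBetween b' h2
  have t3 := dist_triangle q q2 q3
  rcases h3 with h3 | h3
  · exact ⟨a', Or.inl ha', by linarith [dist_triangle q q3 a', (short h3).2]⟩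
  obtain ⟨q4, h4, d4⟩ := hX.exists_near_of_metricBetween b h3
  have t4 := dist_triangle q q3 q4
  rcases h4 with h4 | h4
  · exact ⟨q4, Or.inr (vertex_convex hA w b' hb' b hb _ h4), by linarith⟩
  · refine ⟨b, Or.inr hb, ?_⟩
    have := (short h4).2
    rw [dist_comm b y] at this
    linarith [dist_triangle q q4 b]

theorem graph_isHyperbolic [CompleteSpace X] [Nonempty X] (hX : IsCATNegOne X)
    (hA : ∀ A ∈ 𝒜, A.Nonempty ∧ IsClosed A ∧ IsGeodesicallyConvex A) : net.graph.IsHyperbolic := by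
  have hconn := net.graph_connected hX hA
  obtain ⟨B, hB⟩ := exists_dist_le_of_rep (net := net) hX (15 + net.R)
  have hR := net.R_pos
  choose proj hproj using net.exists_rep
  have model : CoarseGraphModel X net.graph :=
    { rep := Rep
      proj := proj
      D := B + 1
      connected := hconn
      rep_proj := hproj
      exists_rep := fun v => by
        obtain ⟨x, hx⟩ := vertex_nonempty hA v
        exact ⟨x, rep_of_mem hx⟩
      dist_proj_le := fun x y hd => (hB (hproj x) (hproj y) (by linarith)).trans (Nat.le_succ B)
      dist_between_le := fun v w x y q hx hy hvw hq => by
        obtain ⟨s, hs, hd⟩ := exists_near_vertex hX hA hx hy hvw hq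
        rcases hs with hs | hs
        · exact (hB (hproj q) (rep_of_mem hs) (by linarith)).trans (Nat.le_succ B)
        · have h1 := hB (hproj q) (rep_of_mem hs) (by linarith)
          have h2 : net.graph.dist w v ≤ 1 := by
            rcases hvw with h | h
            · rw [h, SimpleGraph.dist_self]; exact Nat.zero_le 1
            · rw [SimpleGraph.dist_comm, SimpleGraph.dist_eq_one_iff_adj.mpr h]
          have := hconn.dist_triangle (u := proj q) (v := w) (w := v)
          omega }
  exact model.isHyperbolic hX

end ConingNet

/-- A finite group is hyperbolic relative to the empty family. -/
theorem isHyperbolicRelativeTo_empty_of_finite (G : Type u) [Group G] [Finite G] :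
    IsHyperbolicRelativeTo G (∅ : Set (Subgroup G)) := by
  refine ⟨PUnit, ⊥, 1, ?_, ⟨0, by simp⟩, ?_, ⟨Set.univ, Set.toFinite _, fun v => ⟨v, trivial, 1, rfl⟩⟩,
    ⟨∅, Set.finite_empty, by simp⟩, by simp, by simp, fun v h => absurd (Set.toFinite _) h⟩
  · rw [SimpleGraph.connected_iff]
    exact ⟨fun v w => by rw [Subsingleton.elim v w], inferInstance⟩
  · intro n e he
    simp at he

/-! ### Relative hyperbolicity -/

theorem theorem3p1 {X : Type u} [MetricSpace X] [CompleteSpace X] (hX : IsCATNegOne X)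
    (ε : ℝ) (hε : 0 < ε) (H : Subgroup (X ≃ᵢ X)) (𝒜 : Set (Set X))
    (hinv : ∀ h ∈ H, ∀ A ∈ 𝒜, h '' A ∈ 𝒜)
    (hsep : IsSeparatedFamily ε 𝒜)
    (hA : ∀ A ∈ 𝒜, A.Nonempty ∧ IsClosed A ∧ IsGeodesicallyConvex A)
    (hlc : LocallyCompactSpace ↥(⋃ A ∈ 𝒜, interior A)ᶜ)
    (hpd : ActsProperlyDiscontinuouslyOn H (⋃ A ∈ 𝒜, interior A)ᶜ)
    (hcc : ActsCocompactlyOn H (⋃ A ∈ 𝒜, interior A)ᶜ) :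
    IsHyperbolicRelativeTo H {P | ∃ A ∈ 𝒜, P = setStabilizer H A} := by
  rcases isEmpty_or_nonempty X with hempty | hne
  · have hsub : Subsingleton (X ≃ᵢ X) := ⟨fun f g => IsometryEquiv.ext fun x => hempty.elim x⟩
    have hfin : Finite H :=
      @Finite.of_subsingleton _ ⟨fun a b => Subtype.ext (Subsingleton.elim a.1 b.1)⟩
    have h𝒜 : {P | ∃ A ∈ 𝒜, P = setStabilizer H A} = ∅ := by
      rw [Set.eq_empty_iff_forall_notMem]
      rintro _ ⟨A, hA', -⟩
      obtain ⟨x, -⟩ := (hA A hA').1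
      exact hempty.false x
    rw [h𝒜]
    exact isHyperbolicRelativeTo_empty_of_finite H
  · obtain ⟨net⟩ := exists_coningNet hε hinv hsep hlc hpd hcc
    refine ⟨net.Vertex, net.graph, net.action hinv, net.graph_connected hX hA,
      ConingNet.graph_isHyperbolic hX hA, ConingNet.graph_isFine hX hA,
      ConingNet.finite_vertex_orbits hX hinv hA, ConingNet.finite_edge_orbits hinv,
      ConingNet.finite_edge_stabilizer hinv hpd, ?_, ?_⟩
    · rintro _ ⟨A, hA', rfl⟩
      exact ⟨⟨A, Or.inl hA'⟩, ConingNet.vertexStabilizer_action hinv _⟩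
    · intro v hinf
      by_cases hv : v.1 ∈ 𝒜
      · exact ⟨v.1, hv, ConingNet.vertexStabilizer_action hinv v⟩
      · exact absurd (ConingNet.finite_vertexStabilizer hinv hpd hv) hinf
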